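/- Let $n\equiv 2$ or $3 \pmod 4$ and let $Cl_n=Cl_{n,0}$ be the real Clifford algebra of Euclidean $\mathbb R^n$ (so $x^2=|x|^2$ for vectors $x$), with reverse $M\mapsto\widetilde M$, scalar part $\langle M\rangle_0$, modulus $|M|^2=\langle M\widetilde M\rangle_0$ and pseudoscalar $i_n=e_1e_2\cdots e_n$, for which $i_n^2=-1$. For a measure $\mu$ and a $Cl_n$-valued function $f$ put $\|f\|^2_{L^2(\mu)}=\int |f|^2\,d\mu\in[0,\infty]$. For $f\in L^2(\mathbb R^n;Cl_n)$ let $\widehat f(\omega)=\int_{\mathbb R^n} f(x)\,e^{-i_n\omega\cdot x}\,d^nx$ be its Clifford Fourier transform, understood as the $L^2$-limit for $R\to\infty$ of the integrals over $\{|x|\le R\}$. Let $d\theta$ be a Haar measure on $SO(n)$, and let $d\mu=\frac{da\,d\theta}{a^{n+1}}$ on $\mathbb R^+\times SO(n)$ and $d\lambda=d\mu\,d^nb$ on $\mathcal G=SIM(n)=\mathbb R^+\times SO(n)\rtimes\mathbb R^n$. Let $\psi\in L^2(\mathbb R^n;Cl_n)$, with values a.e. in the even part $Cl_n^+$ or values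 a.e. in the odd part $Cl_n^-$ if $n\equiv 2\pmod 4$, be an admissible wavelet with scalar admissibility constant; that is, for almost every $\omega\in\mathbb R^n$ the integral $$C_\psi=\int_{\mathbb R^+}\int_{SO(n)}a^n\,\widetilde{\widehat\psi(a\,r_\theta^{-1}\omega)}\;\widehat\psi(a\,r_\theta^{-1}\omega)\,d\mu(a,\theta)$$ converges absolutely, its value does not depend on $\omega$, and this value $C_\psi$ is invertible in $Cl_n$ and is a scalar, $C_\psi\in\mathbb R$. For $f\in L^2(\mathbb R^n;Cl_n)$ let $$T_\psi f(a,\theta,b)=\int_{\mathbb R^n}f(x)\,\widetilde{\psi_{a,\theta,b}(x)}\,d^nx,\qquad \psi_{a,\theta,b}(x)=a^{-n/2}\,\psi\!\left(r_\theta^{-1}\left(\tfrac{x-b}{a}\right)\right).$$ Then for every $f\in L^2(\mathbb R^n;Cl_n)$ $$\|b\,T_\psi f(a,\theta,b)\|^2_{L^2(\mathcal G;Cl_n)}\;\|\omega\widehat f\|^2_{L^2(\mathbb R^n;Cl_n)}\;\ge\; n\,C_\psi\,\frac{(2\pi)^n}{4}\,\|f\|^4_{L^2(\mathbb R^n;Cl_n)},$$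 where $b\,T_\psi f$ and $\omega\widehat f$ are Clifford products with the vectors $b$ and $\omega$, and the norms on the left may be infinite (with $0\cdot\infty=0$). -/

import Mathlib

open MeasureTheory Filter Topology

noncomputable section

namespace CliffordWavelet

/-- Euclidean space `ℝⁿ`. -/
abbrev E (n : ℕ) : Type := EuclideanSpace ℝ (Fin n)

/-- The quadratic form `x ↦ x · x` on `ℝⁿ`. -/
def euclideanForm (n : ℕ) : QuadraticForm ℝ (E n) :=
  LinearMap.BilinMap.toQuadraticMap (innerₗ (E n))

/-- The real Clifford geometric algebra `Clₙ = Cl_{n,0}`. -/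
abbrev Cl (n : ℕ) : Type := CliffordAlgebra (euclideanForm n)

/-- A vector of `ℝⁿ`, seen as a multivector. -/
def vec {n : ℕ} (x : E n) : Cl n := CliffordAlgebra.ι (euclideanForm n) x

/-- The reverse `M̃`. -/
def rev {n : ℕ} (M : Cl n) : Cl n := CliffordAlgebra.reverse M

/-- The scalar part `⟨M⟩₀`: the grade-zero part, the grades being those of the exterior algebra
under the canonical linear isomorphism `Clₙ ≃ ⋀ ℝⁿ`. -/
def scalarPart {n : ℕ} (M : Cl n) : ℝ :=
  ExteriorAlgebra.algebraMapInv (CliffordAlgebra.equivExterior (euclideanForm n) M)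

/-- `|M|² = ⟨M M̃⟩₀`. -/
def modSq {n : ℕ} (M : Cl n) : ℝ := scalarPart (M * rev M)

/-- The basis blade `e_A = e_{i₁} ⋯ e_{iₖ}` for `A = {i₁ < ⋯ < iₖ}`. -/
def blade {n : ℕ} (A : Finset (Fin n)) : Cl n :=
  ((A.sort (· ≤ ·)).map fun i => vec (EuclideanSpace.single i (1 : ℝ))).prod

/-- The blade coefficient `M_A = ⟨M ẽ_A⟩₀` in `M = ∑_A M_A e_A`. -/
def coeff {n : ℕ} (A : Finset (Fin n)) (M : Cl n) : ℝ := scalarPart (M * rev (blade A))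

/-- The unit pseudoscalar `iₙ = e₁ e₂ ⋯ eₙ`. -/
def pseudoscalar (n : ℕ) : Cl n := blade Finset.univ

/-- `exp (t iₙ) = cos t + iₙ sin t`, for `iₙ² = -1`. -/
def expI (n : ℕ) (t : ℝ) : Cl n :=
  algebraMap ℝ (Cl n) (Real.cos t) + Real.sin t • pseudoscalar n

section Integration

variable {n : ℕ} {α : Type*} [MeasurableSpace α]

/-- Integrability of a multivector function: every blade component is integrable. -/
def ClIntegrable (μ : Measure α) (f : α → Cl n) : Prop :=
  ∀ A : Finset (Fin n), Integrable (fun x => coeff A (f x)) μ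

/-- The multivector integral `∫ f dμ = ∑_A (∫ f_A dμ) e_A`. -/
def clIntegral (μ : Measure α) (f : α → Cl n) : Cl n :=
  ∑ A : Finset (Fin n), (∫ x, coeff A (f x) ∂μ) • blade A

/-- `‖f‖² = ∫ |f|² dμ`, possibly infinite. -/
def normSq (μ : Measure α) (f : α → Cl n) : ENNReal :=
  ∫⁻ x, ENNReal.ofReal (modSq (f x)) ∂μ

/-- `f ∈ L²(μ; Clₙ)`. -/
def MemL2 (μ : Measure α) (f : α → Cl n) : Prop :=
  (∀ A : Finset (Fin n), AEStronglyMeasurable (fun x => coeff A (f x)) μ) ∧ normSq μ f < ⊤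

end Integration

/-- The Clifford Fourier integral `∫ f(x) exp(-iₙ ω·x) dⁿx`. -/
def cftIntegral {n : ℕ} (f : E n → Cl n) (ω : E n) : Cl n :=
  clIntegral volume fun x => f x * expI n (-(inner ℝ ω x))

/-- `g` is the Clifford Fourier transform of `f` in the sense of Plancherel:
`g ∈ L²` is the `L²`-limit of `∫_{|x| ≤ R} f(x) exp(-iₙ ω·x) dⁿx` as `R → ∞`. -/
def IsCFT {n : ℕ} (f g : E n → Cl n) : Prop :=
  MemL2 volume g ∧
    Tendsto
      (fun R : ℝ =>
        normSq volume fun ω => cftIntegral ((Metric.closedBall 0 R).indicator f) ω - g ω)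
      atTop (𝓝 0)

/-- The Clifford Fourier transform `f̂` of `f ∈ L²(ℝⁿ; Clₙ)`: a representative of the almost
everywhere unique function in `IsCFT`. -/
def cft {n : ℕ} (f : E n → Cl n) : E n → Cl n := Classical.epsilon (IsCFT f)

/-- The rotation group `SO(n)`. -/
abbrev SO (n : ℕ) : Type := Matrix.specialOrthogonalGroup (Fin n) ℝ

instance instMeasurableSpaceSO (n : ℕ) : MeasurableSpace (SO n) := borel (SO n)

instance instBorelSpaceSO (n : ℕ) : BorelSpace (SO n) := ⟨rfl⟩

/-- The action of `SO(n)` on `ℝⁿ`. -/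
def rot {n : ℕ} (r : SO n) (x : E n) : E n :=
  Matrix.toEuclideanLin (r : Matrix (Fin n) (Fin n) ℝ) x

/-- `dμ(a, θ) = da dθ / a^(n+1)` on `ℝ⁺ × SO(n)`, for a Haar measure `dθ = ν` on `SO(n)`. -/
def dilRotMeasure {n : ℕ} (ν : Measure (SO n)) : Measure (ℝ × SO n) :=
  ((volume.restrict (Set.Ioi (0 : ℝ))).withDensity
    fun a => ENNReal.ofReal (1 / a ^ (n + 1))).prod ν

/-- `dλ(a, θ, b) = dμ(a, θ) dⁿb` on `SIM(n) = ℝ⁺ × SO(n) ⋊ ℝⁿ`. -/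
def simMeasure {n : ℕ} (ν : Measure (SO n)) : Measure ((ℝ × SO n) × E n) :=
  (dilRotMeasure ν).prod volume

/-- The daughter wavelet `ψ_{a,θ,b}(x) = a^{-n/2} ψ(r_θ⁻¹((x - b)/a))`. -/
def daughter {n : ℕ} (ψ : E n → Cl n) (a : ℝ) (r : SO n) (b : E n) (x : E n) : Cl n :=
  (1 / a ^ ((n : ℝ) / 2)) • ψ (rot r⁻¹ (a⁻¹ • (x - b)))

/-- The wavelet transform `T_ψ f(a,θ,b) = ∫ f(x) ψ̃_{a,θ,b}(x) dⁿx`. -/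
def waveletTransform {n : ℕ} (ψ f : E n → Cl n) (p : (ℝ × SO n) × E n) : Cl n :=
  clIntegral volume fun x => f x * rev (daughter ψ p.1.1 p.1.2 p.2 x)

/-- The integrand `aⁿ {ψ̂(a r_θ⁻¹(ω))}~ ψ̂(a r_θ⁻¹(ω))` of the admissibility constant. -/
def admissibilityIntegrand {n : ℕ} (ψ : E n → Cl n) (ω : E n) (p : ℝ × SO n) : Cl n :=
  p.1 ^ n • (rev (cft ψ (p.1 • rot p.2⁻¹ ω)) * cft ψ (p.1 • rot p.2⁻¹ ω))

/-- `ψ` is an admissible mother wavelet with admissibility constant `C_ψ = C`. -/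
structure IsAdmissible {n : ℕ} (ν : Measure (SO n)) (ψ : E n → Cl n) (C : Cl n) : Prop where
  memL2 : MemL2 volume ψ
  /-- For `n = 2 (mod 4)` a mother wavelet is of even or of odd grade. -/
  parity : n % 4 = 2 →
    (∀ᵐ x, ψ x ∈ CliffordAlgebra.evenOdd (euclideanForm n) 0) ∨
    (∀ᵐ x, ψ x ∈ CliffordAlgebra.evenOdd (euclideanForm n) 1)
  /-- The defining integral is finite and has the constant value `C` at almost every `ω`. -/
  finite_const : ∀ᵐ ω : E n,
    ClIntegrable (dilRotMeasure ν) (admissibilityIntegrand ψ ω) ∧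
    clIntegral (dilRotMeasure ν) (admissibilityIntegrand ψ ω) = C
  invertible : IsUnit C

end CliffordWavelet

end

/-! Since `iₙ² = -1`, right multiplication by `iₙ` makes `Clₙ` a complex Hilbert space, for which
the Clifford Fourier transform is the vector-valued Fourier transform; Plancherel's theorem gives
`‖f̂‖² = (2π)ⁿ ‖f‖²`. In the variable `b`, the wavelet transform `T_ψ f(a, θ, b)` is an inverse
Fourier transform of a product of `f̂` with the reverse of the dilated and rotated `ψ̂`, so
integrating over `a` and `θ` turns Plancherel's theorem and admissibility into
`‖T_ψ f‖² = C_ψ ‖f‖²`.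

Translating `T_ψ f` in `b` amounts to translating `f`, that is, to modulating `f̂`. The difference
of two translates along the `j`-th axis is therefore bounded by `|s - t|` times a multiple of
`‖ω_j f̂‖`. Multiplication by `b_j` fails to commute with translation by `t` along that axis by
exactly `t`, and Heisenberg's argument, with difference quotients in place of derivatives, gives
`‖b_j T_ψ f‖² ‖ω_j f̂‖² ≥ C_ψ (2π)ⁿ / 4 ‖f‖⁴`. The factor `n` appears on summing over `j`, because
`|b M|² = ∑ b_j² |M|²` in the Clifford algebra.
-/

noncomputable section

namespace CliffordWavelet

/-! ### Blades -/

section EqSign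

variable {R : Type*} [Monoid R] [HasDistribNeg R] {x y z x' y' : R}

/-- Equality up to sign. -/
def EqSign (x y : R) : Prop := x = y ∨ x = -y

lemma EqSign.refl (x : R) : EqSign x x := Or.inl rfl

lemma EqSign.symm (h : EqSign x y) : EqSign y x := by
  rcases h with rfl | rfl
  · exact Or.inl rfl
  · exact Or.inr (neg_neg _).symm

lemma EqSign.trans (h : EqSign x y) (h' : EqSign y z) : EqSign x z := by
  rcases h with rfl | rfl <;> rcases h' with rfl | rfl <;> simp [EqSign]

lemma EqSign.mul (h : EqSign x y) (h' : EqSign x' y') : EqSign (x * x') (y * y') := by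
  rcases h with rfl | rfl <;> rcases h' with rfl | rfl <;> simp [EqSign]

end EqSign

section Blades

variable {n : ℕ}

lemma euclideanForm_apply (x : E n) : euclideanForm n x = ‖x‖ ^ 2 := by
  simp [euclideanForm, LinearMap.BilinMap.toQuadraticMap_apply]

lemma vec_mul_vec (x : E n) : vec x * vec x = algebraMap ℝ (Cl n) (‖x‖ ^ 2) := by
  rw [vec, CliffordAlgebra.ι_sq_scalar, euclideanForm_apply]

/-- The basis vector `e_i` as a multivector. -/
def basisVec (i : Fin n) : Cl n := vec (EuclideanSpace.single i (1 : ℝ))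

lemma vec_eq_sum_basisVec (x : E n) : vec x = ∑ i, x i • (basisVec i : Cl n) := by
  conv_lhs => rw [← (EuclideanSpace.basisFun (Fin n) ℝ).sum_repr x]
  simp [basisVec, vec]

lemma basisVec_mul_self (i : Fin n) : (basisVec i : Cl n) * basisVec i = 1 := by
  simp [basisVec, vec_mul_vec]

lemma basisVec_mul_comm {i j : Fin n} (h : i ≠ j) :
    (basisVec i : Cl n) * basisVec j = -(basisVec j * basisVec i) := by
  have h0 : QuadraticMap.polar (euclideanForm n) (EuclideanSpace.single i (1 : ℝ))
      (EuclideanSpace.single j (1 : ℝ)) = 0 := by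
    rw [euclideanForm, LinearMap.BilinMap.polar_toQuadraticMap]
    simp [EuclideanSpace.inner_single_left, h, h.symm]
  rw [eq_neg_iff_add_eq_zero, basisVec, basisVec, vec, vec, CliffordAlgebra.ι_mul_ι_add_swap, h0,
    map_zero]

lemma rev_one : rev (1 : Cl n) = 1 := CliffordAlgebra.reverse.map_one

lemma rev_mul (M N : Cl n) : rev (M * N) = rev N * rev M := CliffordAlgebra.reverse.map_mul M N

lemma rev_rev (M : Cl n) : rev (rev M) = M := CliffordAlgebra.reverse_reverse M

lemma rev_add (M N : Cl n) : rev (M + N) = rev M + rev N := map_add _ M N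

lemma rev_smul (c : ℝ) (M : Cl n) : rev (c • M) = c • rev M := map_smul _ c M

lemma rev_vec (x : E n) : rev (vec x) = vec x := CliffordAlgebra.reverse_ι x

lemma rev_algebraMap (c : ℝ) : rev (algebraMap ℝ (Cl n) c) = algebraMap ℝ (Cl n) c :=
  CliffordAlgebra.reverse.commutes c

/-- The product `e_{i₁} ⋯ e_{iₖ}` along a list of indices, so that `blade A` is the case of the
sorted list of elements of `A`. -/
def listBlade (l : List (Fin n)) : Cl n := (l.map basisVec).prod

lemma listBlade_nil : listBlade ([] : List (Fin n)) = 1 := rfl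

lemma listBlade_cons (i : Fin n) (l : List (Fin n)) :
    listBlade (i :: l) = basisVec i * listBlade l := by
  simp [listBlade]

lemma listBlade_append (l l' : List (Fin n)) :
    listBlade (l ++ l') = listBlade l * listBlade l' := by
  simp [listBlade]

lemma blade_eq_listBlade (A : Finset (Fin n)) : blade A = listBlade (A.sort (· ≤ ·)) := rfl

lemma blade_empty : blade (∅ : Finset (Fin n)) = 1 := by simp [blade]

lemma rev_listBlade (l : List (Fin n)) : rev (listBlade l) = listBlade l.reverse := by
  induction l with
  | nil => exact rev_one
  | cons i l ih =>
    rw [listBlade_cons, rev_mul, ih, List.reverse_cons, listBlade_append, listBlade_cons,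
      listBlade_nil, mul_one, basisVec, rev_vec]

lemma listBlade_mul_rev (l : List (Fin n)) : listBlade l * rev (listBlade l) = 1 := by
  induction l with
  | nil => simp [listBlade_nil, rev_one]
  | cons i l ih =>
    rw [listBlade_cons, rev_mul, mul_assoc, ← mul_assoc (listBlade l), ih, one_mul, basisVec,
      rev_vec]
    exact basisVec_mul_self i

lemma blade_mul_rev (A : Finset (Fin n)) : blade A * rev (blade A) = 1 := listBlade_mul_rev _

lemma eqSign_listBlade_of_perm {l l' : List (Fin n)} (h : l.Perm l') :
    EqSign (listBlade l) (listBlade l') := by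
  induction h with
  | nil => exact .refl _
  | cons i _ ih => simpa only [listBlade_cons] using (EqSign.refl (basisVec i)).mul ih
  | swap i j l =>
    simp only [listBlade_cons, ← mul_assoc]
    refine EqSign.mul ?_ (.refl _)
    by_cases hij : i = j
    · subst hij; exact .refl _
    · exact Or.inr (basisVec_mul_comm (Ne.symm hij))
  | trans _ _ ih ih' => exact ih.trans ih'

lemma eqSign_rev_blade (A : Finset (Fin n)) : EqSign (rev (blade A)) (blade A) := by
  rw [blade_eq_listBlade, rev_listBlade]
  exact eqSign_listBlade_of_perm (List.reverse_perm _)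

lemma eqSign_basisVec_mul_blade_of_notMem {i : Fin n} {A : Finset (Fin n)} (h : i ∉ A) :
    EqSign (basisVec i * blade A) (blade (insert i A)) := by
  rw [blade_eq_listBlade, blade_eq_listBlade, ← listBlade_cons]
  refine eqSign_listBlade_of_perm ?_
  rw [← Multiset.coe_eq_coe, ← Multiset.cons_coe, Finset.sort_eq, Finset.sort_eq,
    Finset.insert_val_of_notMem h]

lemma eqSign_basisVec_mul_blade (i : Fin n) (A : Finset (Fin n)) :
    EqSign (basisVec i * blade A) (blade (symmDiff {i} A)) := by
  by_cases h : i ∈ A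
  · have hA : symmDiff {i} A = A.erase i := by
      ext j; by_cases hj : j = i <;> simp [Finset.mem_symmDiff, hj, h]
    have h_insert := eqSign_basisVec_mul_blade_of_notMem (Finset.notMem_erase i A)
    rw [Finset.insert_erase h] at h_insert
    have h_mul := (EqSign.refl (basisVec i)).mul h_insert.symm
    rwa [← mul_assoc, basisVec_mul_self, one_mul, ← hA] at h_mul
  · have hA : symmDiff {i} A = insert i A := by
      ext j; by_cases hj : j = i <;> simp [Finset.mem_symmDiff, hj, h]
    rw [hA]
    exact eqSign_basisVec_mul_blade_of_notMem h

lemma eqSign_listBlade_mul_blade {l : List (Fin n)} (hl : l.Nodup) (B : Finset (Fin n)) :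
    EqSign (listBlade l * blade B) (blade (symmDiff l.toFinset B)) := by
  induction l with
  | nil =>
    rw [listBlade_nil, one_mul, List.toFinset_nil, ← Finset.bot_eq_empty, bot_symmDiff]
    exact .refl _
  | cons i l ih =>
    rw [List.nodup_cons] at hl
    have h_cons : symmDiff (i :: l).toFinset B = symmDiff {i} (symmDiff l.toFinset B) := by
      rw [← symmDiff_assoc]
      congr 1
      ext j; by_cases hj : j = i <;> simp [Finset.mem_symmDiff, hj, hl.1]
    rw [listBlade_cons, mul_assoc, h_cons]
    exact ((EqSign.refl _).mul (ih hl.2)).trans (eqSign_basisVec_mul_blade _ _)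

lemma eqSign_blade_mul_blade (A B : Finset (Fin n)) :
    EqSign (blade A * blade B) (blade (symmDiff A B)) := by
  have h := eqSign_listBlade_mul_blade (A.sort_nodup (· ≤ ·)) B
  rwa [Finset.sort_toFinset] at h

lemma span_range_blade : Submodule.span ℝ (Set.range (blade : Finset (Fin n) → Cl n)) = ⊤ := by
  rw [eq_top_iff]
  rintro M -
  induction M using CliffordAlgebra.left_induction with
  | algebraMap r =>
    rw [Algebra.algebraMap_eq_smul_one, ← blade_empty]
    exact Submodule.smul_mem _ _ (Submodule.subset_span ⟨_, rfl⟩)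
  | add M N hM hN => exact add_mem hM hN
  | ι_mul M x hM =>
    rw [show CliffordAlgebra.ι (euclideanForm n) x = vec x from rfl, vec_eq_sum_basisVec,
      Finset.sum_mul]
    refine sum_mem fun i _ => ?_
    rw [smul_mul_assoc]
    refine Submodule.smul_mem _ _ ?_
    induction hM using Submodule.span_induction with
    | mem M hM =>
      obtain ⟨A, rfl⟩ := hM
      rcases eqSign_basisVec_mul_blade i A with h | h <;> rw [h]
      · exact Submodule.subset_span ⟨_, rfl⟩
      · exact neg_mem (Submodule.subset_span ⟨_, rfl⟩)
    | zero => simp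
    | add M N _ _ hM hN => rw [mul_add]; exact add_mem hM hN
    | smul c M _ hM => rw [mul_smul_comm]; exact Submodule.smul_mem _ _ hM

lemma exists_eq_sum_blade (M : Cl n) : ∃ c : Finset (Fin n) → ℝ, M = ∑ A, c A • blade A := by
  have hM : M ∈ Submodule.span ℝ (Set.range (blade : Finset (Fin n) → Cl n)) := by
    rw [span_range_blade]; trivial
  obtain ⟨c, hc⟩ := (Submodule.mem_span_range_iff_exists_fun ℝ).1 hM
  exact ⟨c, hc.symm⟩

lemma linearMap_ext_blade {V : Type*} [AddCommMonoid V] [Module ℝ V] {L L' : Cl n →ₗ[ℝ] V}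
    (h : ∀ A, L (blade A) = L' (blade A)) : L = L' :=
  LinearMap.ext_on_range span_range_blade h

/-! ### The scalar part -/

/-- The scalar part as a linear functional. -/
def scalarPartₗ (n : ℕ) : Cl n →ₗ[ℝ] ℝ :=
  (ExteriorAlgebra.algebraMapInv : ExteriorAlgebra ℝ (E n) →ₐ[ℝ] ℝ).toLinearMap ∘ₗ
    (CliffordAlgebra.equivExterior (euclideanForm n)).toLinearMap

lemma scalarPartₗ_apply (M : Cl n) : scalarPartₗ n M = scalarPart M := rfl

lemma scalarPart_add (M N : Cl n) : scalarPart (M + N) = scalarPart M + scalarPart N :=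
  (scalarPartₗ n).map_add M N

lemma scalarPart_neg (M : Cl n) : scalarPart (-M) = -scalarPart M := (scalarPartₗ n).map_neg M

lemma scalarPart_smul (c : ℝ) (M : Cl n) : scalarPart (c • M) = c * scalarPart M :=
  (scalarPartₗ n).map_smul c M

lemma scalarPart_algebraMap (c : ℝ) : scalarPart (algebraMap ℝ (Cl n) c) = c := by
  simp only [scalarPart, CliffordAlgebra.equivExterior, CliffordAlgebra.changeFormEquiv_apply,
    CliffordAlgebra.changeForm_algebraMap]
  exact ExteriorAlgebra.algebraMap_leftInverse _ c

lemma scalarPart_one : scalarPart (1 : Cl n) = 1 := by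
  simpa using scalarPart_algebraMap (n := n) 1

lemma contractLeft_listBlade (d : Module.Dual ℝ (E n)) {l : List (Fin n)}
    (hd : ∀ j ∈ l, d (EuclideanSpace.single j 1) = 0) :
    CliffordAlgebra.contractLeft d (listBlade l) = 0 := by
  induction l with
  | nil => simp [listBlade_nil]
  | cons j l ih =>
    rw [List.forall_mem_cons] at hd
    rw [listBlade_cons, basisVec, vec, CliffordAlgebra.contractLeft_ι_mul, ih hd.2, hd.1]
    simp

lemma scalarPart_listBlade_cons {i : Fin n} {l : List (Fin n)} (h : i ∉ l) :
    scalarPart (listBlade (i :: l)) = 0 := by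
  simp only [scalarPart, CliffordAlgebra.equivExterior, CliffordAlgebra.changeFormEquiv_apply,
    listBlade_cons, basisVec, vec]
  rw [CliffordAlgebra.changeForm_ι_mul, ← CliffordAlgebra.changeForm_contractLeft,
    contractLeft_listBlade, map_zero, sub_zero, map_mul]
  · exact mul_eq_zero_of_left (by simp [ExteriorAlgebra.algebraMapInv]) _
  · intro j hj
    have hij : i ≠ j := fun hij => h (hij ▸ hj)
    rw [map_neg, LinearMap.neg_apply, LinearMap.neg_apply, euclideanForm,
      QuadraticMap.associated_toQuadraticMap]
    simp [EuclideanSpace.inner_single_left, hij, hij.symm]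

lemma scalarPart_blade_of_nonempty {A : Finset (Fin n)} (hA : A.Nonempty) :
    scalarPart (blade A) = 0 := by
  have h_nodup := A.sort_nodup (· ≤ ·)
  rw [blade_eq_listBlade]
  cases hl : A.sort (· ≤ ·) with
  | nil => exact absurd (by rw [← A.sort_toFinset (· ≤ ·), hl, List.toFinset_nil]) hA.ne_empty
  | cons i l => exact scalarPart_listBlade_cons (List.nodup_cons.1 (hl ▸ h_nodup)).1

lemma EqSign.scalarPart_eq_zero {M N : Cl n} (h : EqSign M N) (hN : scalarPart N = 0) :
    scalarPart M = 0 := by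
  rcases h with rfl | rfl
  · exact hN
  · rw [scalarPart_neg, hN, neg_zero]

lemma scalarPart_blade_mul_blade_of_ne {A B : Finset (Fin n)} (h : A ≠ B) :
    scalarPart (blade A * blade B) = 0 :=
  (eqSign_blade_mul_blade A B).scalarPart_eq_zero <| scalarPart_blade_of_nonempty <|
    Finset.symmDiff_nonempty.2 h

lemma scalarPart_blade_mul_rev_blade (A B : Finset (Fin n)) :
    scalarPart (blade A * rev (blade B)) = if A = B then 1 else 0 := by
  split_ifs with h
  · rw [h, blade_mul_rev, scalarPart_one]
  · exact ((EqSign.refl _).mul (eqSign_rev_blade B)).scalarPart_eq_zero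
      (scalarPart_blade_mul_blade_of_ne h)

lemma scalarPart_mul_comm (M N : Cl n) : scalarPart (M * N) = scalarPart (N * M) := by
  have h : (LinearMap.mul ℝ (Cl n)).compr₂ (scalarPartₗ n) =
      (LinearMap.mul ℝ (Cl n)).flip.compr₂ (scalarPartₗ n) := by
    refine linearMap_ext_blade fun A => linearMap_ext_blade fun B => ?_
    simp only [LinearMap.compr₂_apply, LinearMap.flip_apply, LinearMap.mul_apply',
      scalarPartₗ_apply]
    by_cases hAB : A = B
    · rw [hAB]
    · rw [scalarPart_blade_mul_blade_of_ne hAB, scalarPart_blade_mul_blade_of_ne (Ne.symm hAB)]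
  exact congr($h M N)

lemma scalarPart_rev (M : Cl n) : scalarPart (rev M) = scalarPart M := by
  have h : scalarPartₗ n ∘ₗ CliffordAlgebra.reverse = scalarPartₗ n := by
    refine linearMap_ext_blade fun A => ?_
    change scalarPart (rev (blade A)) = scalarPart (blade A)
    rcases A.eq_empty_or_nonempty with rfl | hA
    · rw [blade_empty, rev_one]
    · have hA := scalarPart_blade_of_nonempty hA
      rw [hA, (eqSign_rev_blade A).scalarPart_eq_zero hA]
  exact congr($h M)

/-! ### The Euclidean structure on `Clₙ` -/

lemma modSq_sum_blade (c : Finset (Fin n) → ℝ) :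
    modSq (∑ A, c A • blade A) = ∑ A, c A ^ 2 := by
  have h_mul (A B : Finset (Fin n)) : scalarPart ((c A • blade A) * rev (c B • blade B)) =
      if A = B then c A ^ 2 else 0 := by
    rw [rev_smul, smul_mul_smul_comm, scalarPart_smul, scalarPart_blade_mul_rev_blade]
    split_ifs with h
    · rw [h, mul_one, sq]
    · rw [mul_zero]
  have h_rev : rev (∑ A, c A • blade A) = ∑ A, rev (c A • blade A) :=
    map_sum CliffordAlgebra.reverse _ _
  rw [modSq, h_rev, Finset.sum_mul_sum, ← scalarPartₗ_apply]
  simp only [map_sum, scalarPartₗ_apply, h_mul, Finset.sum_ite_eq, Finset.mem_univ, if_true]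

/-- The inner product `⟨M Ñ⟩₀` on `Clₙ`, whose squared norm is the modulus `modSq`. -/
@[reducible] def innerCore (n : ℕ) : InnerProductSpace.Core ℝ (Cl n) where
  inner M N := scalarPart (M * rev N)
  conj_inner_symm M N := by
    rw [← scalarPart_rev, rev_mul, rev_rev]; rfl
  re_inner_nonneg M := by
    obtain ⟨c, rfl⟩ := exists_eq_sum_blade M
    change 0 ≤ modSq _
    rw [modSq_sum_blade]
    positivity
  add_left M N P := by rw [add_mul, scalarPart_add]
  smul_left M N c := by rw [smul_mul_assoc, scalarPart_smul]; rfl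
  definite M h := by
    obtain ⟨c, rfl⟩ := exists_eq_sum_blade M
    replace h : modSq _ = 0 := h
    rw [modSq_sum_blade, Finset.sum_eq_zero_iff_of_nonneg fun _ _ => sq_nonneg _] at h
    refine Finset.sum_eq_zero fun A hA => ?_
    rw [pow_eq_zero_iff two_ne_zero |>.1 (h A hA), zero_smul]

instance instNormedAddCommGroupCl (n : ℕ) : NormedAddCommGroup (Cl n) :=
  (innerCore n).toNormedAddCommGroup

instance instInnerProductSpaceCl (n : ℕ) : InnerProductSpace ℝ (Cl n) :=
  InnerProductSpace.ofCore (innerCore n).toCore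

lemma inner_eq_scalarPart (M N : Cl n) : inner ℝ M N = scalarPart (M * rev N) := rfl

lemma modSq_eq_norm_sq (M : Cl n) : modSq M = ‖M‖ ^ 2 := by
  rw [← real_inner_self_eq_norm_sq]; rfl

lemma coeff_eq_inner (A : Finset (Fin n)) (M : Cl n) : coeff A M = inner ℝ M (blade A) := rfl

lemma orthonormal_blade : Orthonormal ℝ (blade : Finset (Fin n) → Cl n) := by
  rw [orthonormal_iff_ite]
  exact scalarPart_blade_mul_rev_blade

/-- The orthonormal basis of blades. -/
def bladeBasis (n : ℕ) : OrthonormalBasis (Finset (Fin n)) ℝ (Cl n) :=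
  OrthonormalBasis.mk orthonormal_blade span_range_blade.ge

lemma bladeBasis_apply (A : Finset (Fin n)) : bladeBasis n A = blade A := by
  simp [bladeBasis]

instance instFiniteDimensionalCl (n : ℕ) : FiniteDimensional ℝ (Cl n) :=
  (bladeBasis n).toBasis.finiteDimensional_of_finite

lemma sum_coeff_smul_blade (M : Cl n) : ∑ A, coeff A M • blade A = M := by
  have h := (bladeBasis n).sum_repr' M
  simpa only [bladeBasis_apply, real_inner_comm, coeff_eq_inner] using h

lemma norm_rev (M : Cl n) : ‖rev M‖ = ‖M‖ := by
  rw [← sq_eq_sq₀ (norm_nonneg _) (norm_nonneg _), ← modSq_eq_norm_sq, ← modSq_eq_norm_sq, modSq,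
    rev_rev, scalarPart_mul_comm, modSq]

lemma inner_mul_right_eq (M N P : Cl n) : inner ℝ (M * N) P = inner ℝ M (P * rev N) := by
  rw [inner_eq_scalarPart, inner_eq_scalarPart, rev_mul, rev_rev, mul_assoc]

lemma norm_mul_of_mul_rev {U : Cl n} {r : ℝ} (hr : 0 ≤ r)
    (hU : U * rev U = algebraMap ℝ (Cl n) (r ^ 2)) (M : Cl n) : ‖M * U‖ = r * ‖M‖ := by
  rw [← sq_eq_sq₀ (norm_nonneg _) (by positivity), mul_pow, ← real_inner_self_eq_norm_sq,
    inner_mul_right_eq, mul_assoc, hU, ← Algebra.commutes, ← Algebra.smul_def, inner_smul_right,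
    real_inner_self_eq_norm_sq]

lemma norm_vec_mul (x : E n) (M : Cl n) : ‖vec x * M‖ = ‖x‖ * ‖M‖ := by
  rw [← norm_rev, rev_mul, rev_vec, ← norm_rev M]
  exact norm_mul_of_mul_rev (norm_nonneg x) (by rw [rev_vec, vec_mul_vec]) _

/-! ### The pseudoscalar and the complex structure -/

lemma basisVec_mul_listBlade (j : Fin n) (l : List (Fin n)) :
    basisVec j * listBlade l = (-1 : ℝ) ^ (l.countP (· ≠ j)) • (listBlade l * basisVec j) := by
  induction l with
  | nil => simp [listBlade_nil]
  | cons i l ih =>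
    rw [listBlade_cons]
    by_cases h : i = j
    · subst h
      rw [mul_assoc (basisVec i), ih, mul_smul_comm]
      simp
    · rw [← mul_assoc, basisVec_mul_comm (Ne.symm h), neg_mul, mul_assoc, ih, mul_smul_comm,
        ← neg_smul, mul_assoc, List.countP_cons_of_pos (by simpa using h), pow_succ, mul_neg_one]

lemma rev_listBlade_of_nodup {l : List (Fin n)} (hl : l.Nodup) :
    rev (listBlade l) = (-1 : ℝ) ^ l.length.choose 2 • listBlade l := by
  induction l with
  | nil => simp [listBlade_nil, rev_one]
  | cons i l ih =>
    rw [List.nodup_cons] at hl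
    have h_count : l.countP (· ≠ i) = l.length :=
      List.countP_eq_length.2 fun j hj => by simpa using ne_of_mem_of_not_mem hj hl.1
    have h_sign : (-1 : ℝ) ^ l.length * (-1) ^ l.length = 1 := by
      rw [← mul_pow, neg_one_mul, neg_neg, one_pow]
    rw [listBlade_cons, rev_mul, ih hl.2, basisVec, rev_vec, ← basisVec, basisVec_mul_listBlade,
      h_count, smul_smul, smul_mul_assoc, List.length_cons, Nat.choose_succ_succ' l.length 1,
      Nat.choose_one_right, pow_add, mul_right_comm, h_sign, one_mul]

lemma odd_choose_two (hn : n % 4 = 2 ∨ n % 4 = 3) : Odd (n.choose 2) := by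
  have h_mod : n * (n - 1) % 4 = 2 := by
    rcases hn with h | h
    · rw [Nat.mul_mod, h, show (n - 1) % 4 = 1 by omega]
    · rw [Nat.mul_mod, h, show (n - 1) % 4 = 2 by omega]
  rw [Nat.choose_two_right, Nat.odd_iff]
  omega

lemma rev_pseudoscalar (hn : n % 4 = 2 ∨ n % 4 = 3) : rev (pseudoscalar n) = -pseudoscalar n := by
  rw [pseudoscalar, blade_eq_listBlade, rev_listBlade_of_nodup (Finset.sort_nodup _ _),
    Finset.length_sort, Finset.card_univ, Fintype.card_fin, (odd_choose_two hn).neg_one_pow,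
    neg_one_smul]

lemma pseudoscalar_sq (hn : n % 4 = 2 ∨ n % 4 = 3) : pseudoscalar n * pseudoscalar n = -1 := by
  have h := blade_mul_rev (Finset.univ : Finset (Fin n))
  rw [← pseudoscalar, rev_pseudoscalar hn, mul_neg] at h
  rw [← h, neg_neg]

lemma basisVec_mul_pseudoscalar (j : Fin n) :
    basisVec j * pseudoscalar n = (-1 : ℝ) ^ (n - 1) • (pseudoscalar n * basisVec j) := by
  have h_count : ((Finset.univ : Finset (Fin n)).sort (· ≤ ·)).countP (· ≠ j) = n - 1 := by
    rw [← Multiset.coe_countP, Finset.sort_eq, Multiset.countP_eq_card_filter]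
    change (Finset.univ.filter (· ≠ j)).card = n - 1
    rw [Finset.filter_ne', Finset.card_erase_of_mem (Finset.mem_univ j), Finset.card_univ,
      Fintype.card_fin]
  rw [pseudoscalar, blade_eq_listBlade, basisVec_mul_listBlade, h_count]

lemma vec_mul_pseudoscalar (x : E n) :
    vec x * pseudoscalar n = (-1 : ℝ) ^ (n - 1) • (pseudoscalar n * vec x) := by
  rw [vec_eq_sum_basisVec, Finset.sum_mul, Finset.mul_sum, Finset.smul_sum]
  refine Finset.sum_congr rfl fun i _ => ?_
  rw [smul_mul_assoc, mul_smul_comm, basisVec_mul_pseudoscalar, smul_comm]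

lemma pseudoscalar_mul_of_odd (hn : n % 2 = 1) (M : Cl n) :
    pseudoscalar n * M = M * pseudoscalar n := by
  induction M using CliffordAlgebra.left_induction with
  | algebraMap r => exact (Algebra.commutes r _).symm
  | add M N hM hN => rw [mul_add, add_mul, hM, hN]
  | ι_mul M x hM =>
    have h := vec_mul_pseudoscalar x
    rw [Even.neg_one_pow (Nat.even_iff.2 (by omega)), one_smul, vec] at h
    rw [← mul_assoc, ← h, mul_assoc, hM, mul_assoc]

lemma pseudoscalar_mul_of_even (hn : Even n) (hn0 : n ≠ 0) (M : Cl n) :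
    pseudoscalar n * M = CliffordAlgebra.involute M * pseudoscalar n := by
  induction M using CliffordAlgebra.left_induction with
  | algebraMap r => rw [AlgHom.commutes]; exact (Algebra.commutes r _).symm
  | add M N hM hN => rw [mul_add, map_add, add_mul, hM, hN]
  | ι_mul M x hM =>
    have h := vec_mul_pseudoscalar x
    rw [Odd.neg_one_pow (Nat.Even.sub_odd (by omega) hn odd_one), neg_one_smul, vec] at h
    rw [map_mul, CliffordAlgebra.involute_ι, ← mul_assoc, ← neg_eq_iff_eq_neg.2 h,
      mul_assoc (-_) _ (pseudoscalar n), ← hM, neg_mul, neg_mul, mul_assoc]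

/-- The embedding of `ℂ` into `Clₙ` that maps `i` to the unit pseudoscalar `iₙ`. -/
def ofComplex (hn : n % 4 = 2 ∨ n % 4 = 3) : ℂ →ₐ[ℝ] Cl n :=
  Complex.lift ⟨pseudoscalar n, pseudoscalar_sq hn⟩

lemma ofComplex_apply (hn : n % 4 = 2 ∨ n % 4 = 3) (z : ℂ) :
    ofComplex hn z = algebraMap ℝ (Cl n) z.re + z.im • pseudoscalar n := rfl

lemma ofComplex_exp_mul_I (hn : n % 4 = 2 ∨ n % 4 = 3) (t : ℝ) :
    ofComplex hn (Complex.exp (t * Complex.I)) = expI n t := by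
  rw [ofComplex_apply, Complex.exp_ofReal_mul_I_re, Complex.exp_ofReal_mul_I_im, expI]

lemma rev_ofComplex (hn : n % 4 = 2 ∨ n % 4 = 3) (z : ℂ) :
    rev (ofComplex hn z) = ofComplex hn (starRingEnd ℂ z) := by
  simp [ofComplex_apply, rev_add, rev_algebraMap, rev_smul, rev_pseudoscalar hn]

lemma norm_mul_ofComplex (hn : n % 4 = 2 ∨ n % 4 = 3) (M : Cl n) (z : ℂ) :
    ‖M * ofComplex hn z‖ = ‖z‖ * ‖M‖ := by
  refine norm_mul_of_mul_rev (norm_nonneg z) ?_ M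
  rw [rev_ofComplex, ← map_mul, Complex.mul_conj, Complex.normSq_eq_norm_sq]
  exact (ofComplex hn).commutes _

lemma norm_mul_expI (hn : n % 4 = 2 ∨ n % 4 = 3) (M : Cl n) (t : ℝ) : ‖M * expI n t‖ = ‖M‖ := by
  rw [← ofComplex_exp_mul_I hn, norm_mul_ofComplex, Complex.norm_exp_ofReal_mul_I, one_mul]

lemma norm_mul_expI_sub_le (hn : n % 4 = 2 ∨ n % 4 = 3) (M : Cl n) (s t : ℝ) :
    ‖M * expI n s - M * expI n t‖ ≤ ‖(s - t) • M‖ := by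
  have h_exp : ‖Complex.exp (s * Complex.I) - Complex.exp (t * Complex.I)‖ ≤ ‖s - t‖ := by
    have h := Real.norm_exp_I_mul_ofReal_sub_one_le (x := s - t)
    rw [← one_mul ‖_ - _‖, ← Complex.norm_exp_ofReal_mul_I t, ← norm_mul, mul_sub, mul_one,
      ← Complex.exp_add] at h
    convert h using 4
    push_cast; ring
  rw [← mul_sub, ← ofComplex_exp_mul_I hn, ← ofComplex_exp_mul_I hn, ← map_sub,
    norm_mul_ofComplex, norm_smul]
  gcongr

lemma expI_add (hn : n % 4 = 2 ∨ n % 4 = 3) (s t : ℝ) : expI n (s + t) = expI n s * expI n t := by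
  rw [← ofComplex_exp_mul_I hn, ← ofComplex_exp_mul_I hn, ← ofComplex_exp_mul_I hn, ← map_mul,
    ← Complex.exp_add, ← add_mul, Complex.ofReal_add]

lemma rev_expI (hn : n % 4 = 2 ∨ n % 4 = 3) (t : ℝ) : rev (expI n t) = expI n (-t) := by
  simp [expI, rev_add, rev_algebraMap, rev_smul, rev_pseudoscalar hn]

end Blades

/-! ### Square-integrable functions -/

section SquareIntegrable

variable {α F : Type*} [MeasurableSpace α] {μ : Measure α} [NormedAddCommGroup F]

lemma eLpNorm_two_sq (μ : Measure α) (f : α → F) : eLpNorm f 2 μ ^ 2 = ∫⁻ x, ‖f x‖ₑ ^ 2 ∂μ := by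
  simpa using eLpNorm_nnreal_pow_eq_lintegral (μ := μ) (f := f) (p := 2) two_ne_zero

lemma tendsto_sq_zero_iff {ι : Type*} {l : Filter ι} {u : ι → ENNReal} :
    Tendsto (fun k => u k ^ 2) l (𝓝 0) ↔ Tendsto u l (𝓝 0) := by
  refine ⟨fun h => ?_, fun h => by simpa using ENNReal.Tendsto.pow (n := 2) h⟩
  have hroot : Tendsto (fun k => (u k ^ 2) ^ (2⁻¹ : ℝ)) l (𝓝 (0 ^ (2⁻¹ : ℝ))) :=
    h.ennrpow_const _
  have hsqrt : ∀ t : ENNReal, (t ^ 2) ^ (2⁻¹ : ℝ) = t := fun t => by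
    rw [← ENNReal.rpow_natCast, ← ENNReal.rpow_mul]
    norm_num
  simpa [hsqrt] using hroot

lemma integral_norm_sq_eq {f : α → F} (hf : AEStronglyMeasurable f μ) :
    ∫ x, ‖f x‖ ^ 2 ∂μ = (eLpNorm f 2 μ ^ 2).toReal := by
  rw [integral_eq_lintegral_of_nonneg_ae (ae_of_all _ fun x => sq_nonneg ‖f x‖)
    (hf.norm.pow 2), eLpNorm_two_sq]
  simp only [ENNReal.ofReal_pow (norm_nonneg _), ofReal_norm]

lemma lintegral_enorm_sq_eq_ofReal {f : α → F} (hf : MemLp f 2 μ) :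
    ∫⁻ x, ‖f x‖ₑ ^ 2 ∂μ = ENNReal.ofReal (∫ x, ‖f x‖ ^ 2 ∂μ) := by
  rw [integral_norm_sq_eq hf.1, eLpNorm_two_sq, ENNReal.ofReal_toReal]
  exact eLpNorm_two_sq μ f ▸ ENNReal.pow_ne_top hf.2.ne

lemma ae_eq_of_tendsto_eLpNorm_sub {ι : Type*} {l : Filter ι} [l.NeBot] {p : ENNReal}
    (hp : 1 ≤ p) {u : ι → α → F} {f g : α → F} (hu : ∀ k, AEStronglyMeasurable (u k) μ)
    (hf : AEStronglyMeasurable f μ) (hg : AEStronglyMeasurable g μ)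
    (huf : Tendsto (fun k => eLpNorm (u k - f) p μ) l (𝓝 0))
    (hug : Tendsto (fun k => eLpNorm (u k - g) p μ) l (𝓝 0)) : f =ᵐ[μ] g := by
  have h_zero : eLpNorm (f - g) p μ = 0 := by
    refine le_antisymm (ge_of_tendsto' (by simpa using huf.add hug) fun k => ?_) zero_le
    rw [eLpNorm_sub_comm (u k) f, ← sub_add_sub_cancel f (u k) g]
    exact eLpNorm_add_le (hf.sub (hu k)) ((hu k).sub hg) hp
  filter_upwards [(eLpNorm_eq_zero_iff (hf.sub hg) (zero_lt_one.trans_le hp).ne').1 h_zero]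
    with x hx
  exact sub_eq_zero.1 hx

variable {X : Type*} [PseudoMetricSpace X] [MeasurableSpace X] {m : Measure X} {o : X}

/-- The restriction of `f` to the closed ball of radius `R` about `o`, extended by zero. -/
def trunc (o : X) (f : X → F) (R : ℝ) : X → F := (Metric.closedBall o R).indicator f

variable [OpensMeasurableSpace X]

lemma memLp_trunc {p : ENNReal} {f : X → F} (hf : MemLp f p m) (R : ℝ) :
    MemLp (trunc o f R) p m :=
  hf.indicator measurableSet_closedBall

lemma integrable_trunc [ProperSpace X] [IsFiniteMeasureOnCompacts m] {p : ENNReal} (hp : 1 ≤ p)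
    {f : X → F} (hf : MemLp f p m) (R : ℝ) : Integrable (trunc o f R) m := by
  have : IsFiniteMeasure (m.restrict (Metric.closedBall o R)) :=
    isFiniteMeasure_restrict.2 (isCompact_closedBall o R).measure_ne_top
  exact (integrable_indicator_iff measurableSet_closedBall).2 ((hf.restrict _).integrable hp)

lemma tendsto_eLpNorm_trunc_sub {f : X → F} (hf : MemLp f 2 m) :
    Tendsto (fun R => eLpNorm (trunc o f R - f) 2 m) atTop (𝓝 0) := by
  rw [← tendsto_sq_zero_iff, ← lintegral_zero (μ := m)]
  simp_rw [eLpNorm_two_sq]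
  refine tendsto_lintegral_filter_of_dominated_convergence' (fun x => ‖f x‖ₑ ^ 2)
    (Eventually.of_forall fun R => ?_) (Eventually.of_forall fun R => ae_of_all _ fun x => ?_) ?_
    (ae_of_all _ fun x => ?_)
  · exact ((memLp_trunc hf R).sub hf).1.enorm.pow_const 2
  · by_cases hx : x ∈ Metric.closedBall o R <;> simp [trunc, hx]
  · exact eLpNorm_two_sq m f ▸ ENNReal.pow_ne_top hf.2.ne
  · refine tendsto_const_nhds.congr' ?_
    filter_upwards [eventually_ge_atTop (dist x o)] with R hR
    simp [trunc, Metric.mem_closedBall.2 hR]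

variable [InnerProductSpace ℝ F]

lemma integrable_inner_of_memLp {f g : α → F} (hf : MemLp f 2 μ) (hg : MemLp g 2 μ) :
    Integrable (fun x => inner ℝ (f x) (g x)) μ :=
  memLp_one_iff_integrable.1 ((innerSL ℝ).memLp_of_bilin 1 hf hg)

lemma integral_norm_sub_sq {f g : α → F} (hf : MemLp f 2 μ) (hg : MemLp g 2 μ) :
    ∫ x, ‖f x - g x‖ ^ 2 ∂μ =
      ∫ x, ‖f x‖ ^ 2 ∂μ - 2 * ∫ x, inner ℝ (f x) (g x) ∂μ + ∫ x, ‖g x‖ ^ 2 ∂μ := by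
  have hfg := (integrable_inner_of_memLp hf hg).const_mul 2
  have hff := hf.norm.integrable_sq
  simp_rw [norm_sub_sq_real]
  rw [integral_add (by exact hff.sub hfg) hg.norm.integrable_sq, integral_sub hff hfg,
    integral_const_mul]

end SquareIntegrable

/-! ### Plancherel's theorem for integrable square-integrable functions -/

section Plancherel

open FourierTransform SchwartzMap ContDiff

variable {V F : Type*} [NormedAddCommGroup V] [InnerProductSpace ℝ V] [FiniteDimensional ℝ V]
  [MeasurableSpace V] [BorelSpace V] [NormedAddCommGroup F] [InnerProductSpace ℂ F]
  [CompleteSpace F]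

lemma fourier_ae_eq_fourier_toLp {u : V → F} (h1 : Integrable u) (h2 : MemLp u 2) :
    𝓕 u =ᵐ[volume] (𝓕 (h2.toLp u) : Lp F 2 (volume : Measure V)) := by
  have hcont : Continuous (𝓕 u) :=
    VectorFourier.fourierIntegral_continuous Real.continuous_fourierChar continuous_inner h1
  refine ae_eq_of_integral_contDiff_smul_eq hcont.locallyIntegrable
    ((Lp.memLp _).locallyIntegrable one_le_two) fun g hg hg_supp => ?_
  have hg_supp' : HasCompactSupport (Complex.ofRealCLM ∘ g) := hg_supp.comp_left rfl
  have hg' : ContDiff ℝ ∞ (Complex.ofRealCLM ∘ g) := by fun_prop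
  set φ : 𝓢(V, ℂ) := hg_supp'.toSchwartzMap hg' with hφ
  have hφg : ∀ x (z : F), φ x • z = g x • z := fun x z => by
    simp [hφ, Complex.coe_smul]
  have hdistr := congr($(Lp.fourier_toTemperedDistribution_eq (h2.toLp u)) φ)
  rw [TemperedDistribution.fourier_apply, Lp.toTemperedDistribution_apply,
    Lp.toTemperedDistribution_apply] at hdistr
  simp_rw [hφg] at hdistr
  calc
    ∫ x, g x • 𝓕 u x = ∫ x, φ x • 𝓕 u x := by simp_rw [hφg]
    _ = ∫ x, 𝓕 (φ : V → ℂ) x • u x := by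
      simpa using! (VectorFourier.integral_fourierIntegral_smul_eq_flip (L := innerₗ V)
        (μ := volume) (ν := volume) Real.continuous_fourierChar continuous_inner
        φ.integrable h1).symm
    _ = ∫ x, (𝓕 φ) x • (h2.toLp u : V → F) x := by
      refine integral_congr_ae ?_
      filter_upwards [h2.coeFn_toLp] with x hx
      rw [hx, SchwartzMap.fourier_coe]
    _ = ∫ x, g x • (𝓕 (h2.toLp u) : Lp F 2 (volume : Measure V)) x := hdistr

end Plancherel

/-! ### Integration of multivector functions -/

section Integration

variable {n : ℕ} {α : Type*} [MeasurableSpace α] {μ : Measure α}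

/-- Multiplication of multivectors as a continuous bilinear map. -/
def mulL (n : ℕ) : Cl n →L[ℝ] Cl n →L[ℝ] Cl n := (LinearMap.mul ℝ (Cl n)).toContinuousBilinearMap

instance instContinuousMulCl (n : ℕ) : ContinuousMul (Cl n) := ⟨(mulL n).continuous₂⟩

/-- The reverse as a linear isometry. -/
def revₗᵢ (n : ℕ) : Cl n →ₗᵢ[ℝ] Cl n where
  toLinearMap := CliffordAlgebra.reverse
  norm_map' := norm_rev

@[fun_prop] lemma continuous_rev : Continuous (rev : Cl n → Cl n) := (revₗᵢ n).continuous

@[fun_prop] lemma continuous_expI : Continuous (expI n) := by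
  have : Continuous (algebraMap ℝ (Cl n)) := continuous_algebraMap ℝ (Cl n)
  unfold expI
  fun_prop

lemma aestronglyMeasurable_iff_coeff {f : α → Cl n} : AEStronglyMeasurable f μ ↔
    ∀ A : Finset (Fin n), AEStronglyMeasurable (fun x => coeff A (f x)) μ := by
  refine ⟨fun h A => by simpa only [coeff_eq_inner] using h.inner aestronglyMeasurable_const,
    fun h => ?_⟩
  rw [show f = fun x => ∑ A, coeff A (f x) • blade A by simp only [sum_coeff_smul_blade]]
  exact Finset.aestronglyMeasurable_fun_sum _ fun A _ => (h A).smul_const _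

lemma clIntegrable_iff {f : α → Cl n} : ClIntegrable μ f ↔ Integrable f μ := by
  refine ⟨fun h => ?_, fun h A => by simpa only [coeff_eq_inner] using h.inner_const (blade A)⟩
  rw [show f = fun x => ∑ A, coeff A (f x) • blade A by simp only [sum_coeff_smul_blade]]
  exact integrable_finsetSum _ fun A _ => (h A).smul_const _

lemma clIntegral_eq_integral {f : α → Cl n} (h : Integrable f μ) :
    clIntegral μ f = ∫ x, f x ∂μ := by
  rw [clIntegral, ← sum_coeff_smul_blade (∫ x, f x ∂μ)]
  refine Finset.sum_congr rfl fun A _ => ?_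
  simp_rw [coeff_eq_inner, real_inner_comm (blade A)]
  rw [integral_inner h]

lemma ofReal_modSq (M : Cl n) : ENNReal.ofReal (modSq M) = ‖M‖ₑ ^ 2 := by
  rw [modSq_eq_norm_sq, ENNReal.ofReal_pow (norm_nonneg _), ofReal_norm]

lemma normSq_eq_lintegral (f : α → Cl n) : normSq μ f = ∫⁻ x, ‖f x‖ₑ ^ 2 ∂μ := by
  simp_rw [normSq, ofReal_modSq]

lemma normSq_eq_eLpNorm_sq (f : α → Cl n) : normSq μ f = eLpNorm f 2 μ ^ 2 := by
  rw [eLpNorm_two_sq, normSq_eq_lintegral]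

lemma memL2_iff {f : α → Cl n} : MemL2 μ f ↔ MemLp f 2 μ := by
  rw [MemL2, MemLp, ← aestronglyMeasurable_iff_coeff, normSq_eq_eLpNorm_sq,
    ENNReal.pow_lt_top_iff, or_iff_left two_ne_zero]

lemma normSq_congr_ae {f g : α → Cl n} (h : f =ᵐ[μ] g) : normSq μ f = normSq μ g := by
  rw [normSq_eq_eLpNorm_sq, normSq_eq_eLpNorm_sq, eLpNorm_congr_ae h]

lemma normSq_const_smul (k : ℝ) (f : α → Cl n) :
    normSq μ (fun x => k • f x) = ENNReal.ofReal (k ^ 2) * normSq μ f := by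
  simp_rw [normSq_eq_lintegral, enorm_smul, mul_pow]
  rw [lintegral_const_mul' _ _ (ENNReal.pow_ne_top enorm_ne_top), Real.enorm_eq_ofReal_abs,
    ← ENNReal.ofReal_pow (abs_nonneg k), sq_abs]

lemma clIntegral_congr_ae {f g : α → Cl n} (h : f =ᵐ[μ] g) : clIntegral μ f = clIntegral μ g :=
  Finset.sum_congr rfl fun _ _ => congr_arg (· • _) <| integral_congr_ae <| h.mono fun _ hx => by
    simp only [hx]

lemma integrable_mul_of_memLp {f g : α → Cl n} (hf : MemLp f 2 μ) (hg : MemLp g 2 μ) :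
    Integrable (fun x => f x * g x) μ :=
  memLp_one_iff_integrable.1 ((mulL n).memLp_of_bilin 1 hf hg)

lemma memLp_rev {f : α → Cl n} (hf : MemLp f 2 μ) : MemLp (fun x => rev (f x)) 2 μ :=
  (revₗᵢ n).toContinuousLinearMap.comp_memLp' hf

end Integration

/-! ### Rotations -/

section Rotation

variable {n : ℕ}

lemma coe_inv_SO (r : SO n) :
    ((r⁻¹ : SO n) : Matrix (Fin n) (Fin n) ℝ) = (r : Matrix (Fin n) (Fin n) ℝ).transpose := rfl

lemma transpose_mul_self_SO (r : SO n) :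
    (r : Matrix (Fin n) (Fin n) ℝ).transpose * (r : Matrix (Fin n) (Fin n) ℝ) = 1 :=
  (Matrix.mem_orthogonalGroup_iff' _ _).1 (Matrix.mem_specialOrthogonalGroup_iff.1 r.2).1

lemma rot_inv_rot (r : SO n) (x : E n) : rot r⁻¹ (rot r x) = x := by
  ext i
  simp [rot, Matrix.toLpLin_apply, coe_inv_SO, transpose_mul_self_SO]

lemma rot_rot_inv (r : SO n) (x : E n) : rot r (rot r⁻¹ x) = x := by
  simpa using rot_inv_rot r⁻¹ x

lemma inner_rot_left (r : SO n) (x y : E n) : inner ℝ (rot r x) y = inner ℝ x (rot r⁻¹ y) := by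
  rw [rot, rot, coe_inv_SO, ← Matrix.conjTranspose_eq_transpose_of_trivial,
    Matrix.toEuclideanLin_conjTranspose_eq_adjoint, LinearMap.adjoint_inner_right]

lemma norm_rot (r : SO n) (x : E n) : ‖rot r x‖ = ‖x‖ := by
  rw [← sq_eq_sq₀ (norm_nonneg _) (norm_nonneg _), ← real_inner_self_eq_norm_sq, inner_rot_left,
    rot_inv_rot, real_inner_self_eq_norm_sq]

/-- A rotation as a linear isometric equivalence. -/
def rotIso (r : SO n) : E n ≃ₗᵢ[ℝ] E n where
  toLinearEquiv := LinearEquiv.ofLinearMap (Matrix.toEuclideanLin (r : Matrix (Fin n) (Fin n) ℝ))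
    (Matrix.toEuclideanLin ((r⁻¹ : SO n) : Matrix (Fin n) (Fin n) ℝ))
    (LinearMap.ext fun x => rot_rot_inv r x) (LinearMap.ext fun x => rot_inv_rot r x)
  norm_map' := norm_rot r

lemma rot_smul (r : SO n) (c : ℝ) (x : E n) : rot r (c • x) = c • rot r x := map_smul (rotIso r) c x

lemma rot_one (x : E n) : rot (1 : SO n) x = x := by simp [rot]

lemma continuous_rot : Continuous fun p : SO n × E n => rot p.1 p.2 := by
  simp only [rot, Matrix.toLpLin_apply]
  exact (PiLp.continuous_toLp 2 _).comp <|
    (continuous_subtype_val.comp continuous_fst).matrix_mulVec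
      ((PiLp.continuous_ofLp 2 _).comp continuous_snd)

lemma continuous_inv_SO : Continuous fun r : SO n => r⁻¹ :=
  Continuous.subtype_mk continuous_subtype_val.matrix_transpose _

lemma isClosed_specialOrthogonalGroup (n : ℕ) :
    IsClosed (Matrix.specialOrthogonalGroup (Fin n) ℝ : Set (Matrix (Fin n) (Fin n) ℝ)) := by
  have h_inter : (Matrix.specialOrthogonalGroup (Fin n) ℝ : Set (Matrix (Fin n) (Fin n) ℝ)) =
      {A | A.transpose * A = 1} ∩ {A | A.det = 1} := by
    ext A
    rw [SetLike.mem_coe, Matrix.mem_specialOrthogonalGroup_iff, Matrix.mem_orthogonalGroup_iff']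
    rfl
  rw [h_inter]
  exact (isClosed_eq (by fun_prop) continuous_const).inter
    (isClosed_eq (by fun_prop) continuous_const)

instance instSigmaCompactSpaceSO (n : ℕ) : SigmaCompactSpace (SO n) :=
  have : SigmaCompactSpace (Matrix (Fin n) (Fin n) ℝ) :=
    inferInstanceAs (SigmaCompactSpace (Fin n → Fin n → ℝ))
  (isClosed_specialOrthogonalGroup n).sigmaCompactSpace

end Rotation

/-! ### The action of similarities on functions -/

section Similarity

variable {n : ℕ} {a : ℝ}

/-- The inverse similarity `x ↦ r⁻¹((x - b)/a)`. -/
def simInv (a : ℝ) (r : SO n) (b x : E n) : E n := rot r⁻¹ (a⁻¹ • (x - b))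

/-- The inverse similarity as a homeomorphism. -/
def simInvHomeo (ha : a ≠ 0) (r : SO n) (b : E n) : E n ≃ₜ E n :=
  ((Homeomorph.subRight b).trans (Homeomorph.smulOfNeZero a⁻¹ (inv_ne_zero ha))).trans
    (rotIso r⁻¹).toHomeomorph

lemma coe_simInvHomeo (ha : a ≠ 0) (r : SO n) (b : E n) : ⇑(simInvHomeo ha r b) = simInv a r b :=
  rfl

lemma map_simInv (ha : 0 < a) (r : SO n) (b : E n) :
    Measure.map (simInv a r b) volume = ENNReal.ofReal (a ^ n) • (volume : Measure (E n)) := by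
  have h_comp : simInv a r b = rotIso r⁻¹ ∘ (a⁻¹ • ·) ∘ (· - b) := rfl
  rw [h_comp, ← Measure.map_map (rotIso r⁻¹).continuous.measurable (by fun_prop),
    ← Measure.map_map (by fun_prop) (by fun_prop), (measurePreserving_sub_right volume b).map_eq,
    Measure.map_addHaar_smul volume (inv_ne_zero ha.ne'), Measure.map_smul,
    (rotIso r⁻¹).measurePreserving.map_eq]
  simp [abs_of_pos ha]

lemma quasiMeasurePreserving_simInv (ha : 0 < a) (r : SO n) (b : E n) :
    Measure.QuasiMeasurePreserving (simInv a r b) volume volume :=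
  ⟨(simInvHomeo ha.ne' r b).continuous.measurable,
    map_simInv ha r b ▸ Measure.smul_absolutelyContinuous⟩

lemma smul_rot_inv_eq_simInv (a : ℝ) (r : SO n) (ω : E n) : a • rot r⁻¹ ω = simInv a⁻¹ r 0 ω := by
  rw [simInv, sub_zero, inv_inv, rot_smul]

lemma inner_eq_inner_simInv_add (ha : a ≠ 0) (r : SO n) (b ω x : E n) :
    inner ℝ ω x = inner ℝ (a • rot r⁻¹ ω) (simInv a r b x) + inner ℝ ω b := by
  rw [simInv, real_inner_smul_left, inner_rot_left, inv_inv, rot_rot_inv, inner_smul_right,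
    mul_inv_cancel_left₀ ha, inner_sub_right, sub_add_cancel]

lemma rpow_half_mul_self (ha : 0 < a) (n : ℕ) : a ^ ((n : ℝ) / 2) * a ^ ((n : ℝ) / 2) = a ^ n := by
  rw [← Real.rpow_add ha, add_halves, Real.rpow_natCast]

lemma daughter_apply (u : E n → Cl n) (a : ℝ) (r : SO n) (b x : E n) :
    daughter u a r b x = (a ^ ((n : ℝ) / 2))⁻¹ • u (simInv a r b x) := by
  rw [daughter, one_div, simInv]

lemma daughter_sub (u v : E n → Cl n) (a : ℝ) (r : SO n) (b : E n) :
    daughter (u - v) a r b = daughter u a r b - daughter v a r b := by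
  ext x
  simp only [daughter, Pi.sub_apply, smul_sub]

variable {u : E n → Cl n}

lemma eLpNorm_daughter (u : E n → Cl n) (ha : 0 < a) (r : SO n) (b : E n) :
    eLpNorm (daughter u a r b) 2 volume = eLpNorm u 2 volume := by
  have h_map := (simInvHomeo ha.ne' r b).measurableEmbedding.lintegral_map
    (μ := volume) fun x => ‖u x‖ₑ ^ 2
  rw [coe_simInvHomeo, map_simInv ha, lintegral_smul_measure, smul_eq_mul] at h_map
  refine (ENNReal.pow_right_strictMono two_ne_zero).injective ?_
  simp_rw [eLpNorm_two_sq, daughter_apply, enorm_smul, mul_pow]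
  rw [lintegral_const_mul' _ _ (ENNReal.pow_ne_top enorm_ne_top), ← h_map, ← mul_assoc,
    Real.enorm_of_nonneg (by positivity), ← ENNReal.ofReal_pow (by positivity),
    ← ENNReal.ofReal_mul (by positivity), inv_pow, sq, rpow_half_mul_self ha,
    inv_mul_cancel₀ (by positivity), ENNReal.ofReal_one, one_mul]

lemma aestronglyMeasurable_daughter (hu : AEStronglyMeasurable u) (ha : 0 < a) (r : SO n)
    (b : E n) : AEStronglyMeasurable (daughter u a r b) :=
  (hu.comp_quasiMeasurePreserving (quasiMeasurePreserving_simInv ha r b)).const_smul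
    (1 / a ^ ((n : ℝ) / 2))

lemma memLp_daughter (hu : MemLp u 2) (ha : 0 < a) (r : SO n) (b : E n) :
    MemLp (daughter u a r b) 2 :=
  ⟨aestronglyMeasurable_daughter hu.1 ha r b, (eLpNorm_daughter u ha r b).trans_lt hu.2⟩

lemma integrable_daughter (hu : Integrable u) (ha : 0 < a) (r : SO n) (b : E n) :
    Integrable (daughter u a r b) := by
  have h_map : Integrable u (Measure.map (simInvHomeo ha.ne' r b) volume) := by
    rw [coe_simInvHomeo, map_simInv ha]
    exact hu.smul_measure ENNReal.ofReal_ne_top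
  exact ((simInvHomeo ha.ne' r b).measurableEmbedding.integrable_map_iff.1 h_map).smul
    (1 / a ^ ((n : ℝ) / 2))

lemma integral_daughter (u : E n → Cl n) (ha : 0 < a) (r : SO n) (b : E n) :
    ∫ x, daughter u a r b x = a ^ ((n : ℝ) / 2) • ∫ x, u x := by
  have h_map := (simInvHomeo ha.ne' r b).measurableEmbedding.integral_map (μ := volume) u
  rw [coe_simInvHomeo, map_simInv ha, integral_smul_measure,
    ENNReal.toReal_ofReal (by positivity)] at h_map
  simp_rw [daughter_apply]
  rw [integral_smul, ← h_map, ← rpow_half_mul_self ha, smul_smul,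
    inv_mul_cancel_left₀ (by positivity)]

end Similarity

/-! ### The Clifford Fourier transform -/

section ComplexStructure

variable {n : ℕ}

/-- `Clₙ` as a complex Hilbert space, with `z` acting as right multiplication by `ofComplex z`. -/
def ComplexCl (_ : n % 4 = 2 ∨ n % 4 = 3) : Type := Cl n

variable {hn : n % 4 = 2 ∨ n % 4 = 3}

instance : NormedAddCommGroup (ComplexCl hn) := inferInstanceAs (NormedAddCommGroup (Cl n))

instance : Module ℂ (ComplexCl hn) where
  smul z M := (show Cl n from M) * ofComplex hn z
  one_smul M := show (show Cl n from M) * ofComplex hn 1 = M by rw [map_one, mul_one]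
  mul_smul z w M := by
    change (show Cl n from M) * ofComplex hn (z * w) =
      (show Cl n from M) * ofComplex hn w * ofComplex hn z
    rw [mul_comm z, map_mul, mul_assoc]
  smul_zero z := zero_mul (ofComplex hn z)
  smul_add z M N := add_mul (show Cl n from M) N (ofComplex hn z)
  add_smul z w M := by
    change (show Cl n from M) * ofComplex hn (z + w) =
      (show Cl n from M) * ofComplex hn z + (show Cl n from M) * ofComplex hn w
    rw [map_add, mul_add]
  zero_smul M := show (show Cl n from M) * ofComplex hn 0 = 0 by rw [map_zero, mul_zero]

instance : NormedSpace ℂ (ComplexCl hn) where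
  norm_smul_le z M := (norm_mul_ofComplex hn M z).le

instance : InnerProductSpace ℂ (ComplexCl hn) :=
  InnerProductSpace.ofNorm ℂ fun M N => by
    simp_rw [← sq]
    exact parallelogram_law_with_norm ℝ (show Cl n from M) N

variable (hn) in
/-- The identity map, from `Clₙ` to its version with a complex structure. -/
def toComplexCl : Cl n ≃ₗᵢ[ℝ] ComplexCl hn where
  toFun M := M
  invFun M := M
  map_add' _ _ := rfl
  map_smul' c M := by
    change c • M = M * ofComplex hn (c : ℂ)
    rw [show (c : ℂ) = algebraMap ℝ ℂ c from rfl, (ofComplex hn).commutes, ← Algebra.commutes,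
      ← Algebra.smul_def]
  left_inv _ := rfl
  right_inv _ := rfl
  norm_map' _ := rfl

lemma toComplexCl_mul_ofComplex (M : Cl n) (z : ℂ) :
    toComplexCl hn (M * ofComplex hn z) = z • toComplexCl hn M := rfl

instance : CompleteSpace (ComplexCl hn) := inferInstanceAs (CompleteSpace (Cl n))

end ComplexStructure

section FourierTransform

open FourierTransform

variable {n : ℕ} {f g : E n → Cl n}

lemma isCFT_iff : IsCFT f g ↔ MemLp g 2 ∧
    Tendsto (fun R => eLpNorm (cftIntegral (trunc 0 f R) - g) 2 volume) atTop (𝓝 0) := by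
  simp_rw [IsCFT, memL2_iff, normSq_eq_eLpNorm_sq, tendsto_sq_zero_iff]
  rfl

lemma cft_congr_ae (h : f =ᵐ[volume] g) : cft f = cft g := by
  have h_trunc : ∀ R, cftIntegral (trunc 0 f R) = cftIntegral (trunc 0 g R) := fun R =>
    funext fun ω => clIntegral_congr_ae <| h.mono fun x hx => by
      dsimp only [trunc, Set.indicator]
      rw [hx]
  have h_iff : IsCFT f = IsCFT g := by
    ext u
    simp_rw [isCFT_iff, h_trunc]
  rw [cft, h_iff, cft]

variable (hn : n % 4 = 2 ∨ n % 4 = 3)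

include hn

lemma integrable_mul_expI (hf : Integrable f) (ω : E n) :
    Integrable fun x => f x * expI n (-(inner ℝ ω x)) := by
  refine hf.mono (hf.1.mul (by fun_prop)) (ae_of_all _ fun x => ?_)
  rw [norm_mul_expI hn]

lemma cftIntegral_eq_integral (hf : Integrable f) (ω : E n) :
    cftIntegral f ω = ∫ x, f x * expI n (-(inner ℝ ω x)) :=
  clIntegral_eq_integral (integrable_mul_expI hn hf ω)

lemma toComplexCl_cftIntegral (hf : Integrable f) (ω : E n) :
    toComplexCl hn (cftIntegral f ω) = 𝓕 (toComplexCl hn ∘ f) ((2 * Real.pi)⁻¹ • ω) := by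
  rw [cftIntegral_eq_integral hn hf, Real.fourier_eq']
  refine ((toComplexCl hn).toContinuousLinearEquiv.integral_comp_comm _).symm.trans
    (integral_congr_ae <| ae_of_all _ fun x => ?_)
  have h_phase : -2 * Real.pi * inner ℝ x ((2 * Real.pi)⁻¹ • ω) = -inner ℝ ω x := by
    rw [inner_smul_right, real_inner_comm]
    field_simp
  dsimp only
  rw [h_phase, Function.comp_apply, ← toComplexCl_mul_ofComplex, ofComplex_exp_mul_I]
  rfl

lemma memLp_toComplexCl_comp (hf : MemLp f 2) : MemLp (toComplexCl hn ∘ f) 2 :=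
  (toComplexCl hn).toContinuousLinearEquiv.toContinuousLinearMap.comp_memLp' hf

/-- The class of `f` in the complex Hilbert space `L²(ℝⁿ; Clₙ)`. -/
def complexLp (hf : MemLp f 2) : Lp (ComplexCl hn) 2 (volume : Measure (E n)) :=
  (memLp_toComplexCl_comp hn hf).toLp

lemma fourier_complexLp_sub (hf : MemLp f 2) (hg : MemLp g 2) :
    𝓕 (complexLp hn (hf.sub hg)) = 𝓕 (complexLp hn hf) - 𝓕 (complexLp hn hg) :=
  map_sub (Lp.fourierTransformₗᵢ (E n) (ComplexCl hn)) (complexLp hn hf) (complexLp hn hg)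

lemma enorm_complexLp (hf : MemLp f 2) : ‖complexLp hn hf‖ₑ = eLpNorm f 2 volume := by
  rw [complexLp, Lp.enorm_toLp]
  exact eLpNorm_congr_norm_ae (ae_of_all _ fun x => (toComplexCl hn).norm_map (f x))

/-- The Fourier transform of `f` given by Plancherel's theorem on `L²(ℝⁿ; Clₙ)`. The dilation by
`2π`, written as a `daughter`, passes from the frequency of Mathlib's Fourier transform to the
angular frequency of `cftIntegral`. -/
def fourierLp (hf : MemLp f 2) : E n → Cl n :=
  (2 * Real.pi) ^ ((n : ℝ) / 2) •
    daughter (fun ω => (toComplexCl hn).symm (𝓕 (complexLp hn hf) ω)) (2 * Real.pi) 1 0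

lemma fourierLp_apply (hf : MemLp f 2) (ω : E n) : fourierLp hn hf ω =
    (toComplexCl hn).symm (𝓕 (complexLp hn hf) (simInv (2 * Real.pi) 1 0 ω)) := by
  rw [fourierLp, Pi.smul_apply, daughter_apply, smul_inv_smul₀ (by positivity)]

lemma memLp_fourierLp (hf : MemLp f 2) : MemLp (fourierLp hn hf) 2 :=
  have h := (toComplexCl hn).symm.toContinuousLinearEquiv.toContinuousLinearMap.comp_memLp'
    (Lp.memLp (𝓕 (complexLp hn hf)))
  (memLp_daughter h Real.two_pi_pos 1 0).const_smul _

lemma fourierLp_sub (hf : MemLp f 2) (hg : MemLp g 2) :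
    fourierLp hn (hf.sub hg) =ᵐ[volume] fourierLp hn hf - fourierLp hn hg := by
  have h_sub := Lp.coeFn_sub (𝓕 (complexLp hn hf)) (𝓕 (complexLp hn hg))
  filter_upwards
    [(quasiMeasurePreserving_simInv Real.two_pi_pos (1 : SO n) 0).tendsto_ae h_sub] with ω hω
  rw [Pi.sub_apply, fourierLp_apply, fourierLp_apply, fourierLp_apply,
    fourier_complexLp_sub hn hf hg, ← map_sub]
  exact congr_arg _ hω

lemma eLpNorm_fourierLp (hf : MemLp f 2) : eLpNorm (fourierLp hn hf) 2 volume =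
    ENNReal.ofReal ((2 * Real.pi) ^ ((n : ℝ) / 2)) * eLpNorm f 2 volume := by
  have h_norm : ‖𝓕 (complexLp hn hf)‖ₑ = ‖complexLp hn hf‖ₑ := by
    rw [← ofReal_norm, ← ofReal_norm, Lp.norm_fourier_eq]
  rw [fourierLp, eLpNorm_const_smul, eLpNorm_daughter _ Real.two_pi_pos,
    Real.enorm_of_nonneg (by positivity), ← enorm_complexLp hn hf, ← h_norm, Lp.enorm_def]
  rfl

lemma fourierLp_ae_eq_cftIntegral (h1 : Integrable f) (hf : MemLp f 2) :
    fourierLp hn hf =ᵐ[volume] cftIntegral f := by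
  have h1' : Integrable (toComplexCl hn ∘ f) :=
    (toComplexCl hn).toContinuousLinearEquiv.toContinuousLinearMap.integrable_comp h1
  filter_upwards [(quasiMeasurePreserving_simInv Real.two_pi_pos (1 : SO n) 0).tendsto_ae
    (fourier_ae_eq_fourier_toLp h1' (memLp_toComplexCl_comp hn hf))] with ω hω
  rw [fourierLp_apply, complexLp, ← hω, (toComplexCl hn).symm_apply_eq,
    toComplexCl_cftIntegral hn h1, simInv, sub_zero, inv_one, rot_one]

lemma continuous_cftIntegral (hf : Integrable f) : Continuous (cftIntegral f) := by
  have h_eq : cftIntegral f =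
      fun ω => (toComplexCl hn).symm (𝓕 (toComplexCl hn ∘ f) ((2 * Real.pi)⁻¹ • ω)) :=
    funext fun ω => by rw [← toComplexCl_cftIntegral hn hf, LinearIsometryEquiv.symm_apply_apply]
  have h_cont : Continuous (𝓕 (toComplexCl hn ∘ f)) :=
    VectorFourier.fourierIntegral_continuous Real.continuous_fourierChar continuous_inner
      ((toComplexCl hn).toContinuousLinearEquiv.toContinuousLinearMap.integrable_comp hf)
  rw [h_eq]
  exact (toComplexCl hn).symm.continuous.comp (h_cont.comp (continuous_const_smul _))

lemma eLpNorm_cftIntegral_sub_fourierLp (hf : MemLp f 2) (h1 : Integrable g) (hg : MemLp g 2) :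
    eLpNorm (cftIntegral g - fourierLp hn hf) 2 volume =
      ENNReal.ofReal ((2 * Real.pi) ^ ((n : ℝ) / 2)) * eLpNorm (g - f) 2 volume := by
  rw [← eLpNorm_fourierLp hn (hg.sub hf)]
  refine eLpNorm_congr_ae ?_
  filter_upwards [fourierLp_sub hn hg hf, fourierLp_ae_eq_cftIntegral hn h1 hg] with ω h_sub h_int
  rw [h_sub, Pi.sub_apply, Pi.sub_apply, h_int]

lemma isCFT_fourierLp (hf : MemLp f 2) : IsCFT f (fourierLp hn hf) := by
  refine isCFT_iff.2 ⟨memLp_fourierLp hn hf, ?_⟩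
  simp_rw [eLpNorm_cftIntegral_sub_fourierLp hn hf (integrable_trunc one_le_two hf _)
    (memLp_trunc hf _)]
  simpa using ENNReal.Tendsto.const_mul (tendsto_eLpNorm_trunc_sub hf)
    (Or.inr ENNReal.ofReal_ne_top)

lemma isCFT_cft (hf : MemLp f 2) : IsCFT f (cft f) :=
  Classical.epsilon_spec ⟨_, isCFT_fourierLp hn hf⟩

lemma memLp_cft (hf : MemLp f 2) : MemLp (cft f) 2 := (isCFT_iff.1 (isCFT_cft hn hf)).1

lemma cft_ae_eq_fourierLp (hf : MemLp f 2) : cft f =ᵐ[volume] fourierLp hn hf :=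
  ae_eq_of_tendsto_eLpNorm_sub one_le_two
    (fun _ => (continuous_cftIntegral hn
      (integrable_trunc one_le_two hf _)).aestronglyMeasurable)
    (memLp_cft hn hf).1 (memLp_fourierLp hn hf).1 (isCFT_iff.1 (isCFT_cft hn hf)).2
    (isCFT_iff.1 (isCFT_fourierLp hn hf)).2

lemma cft_ae_eq_cftIntegral (h1 : Integrable f) (hf : MemLp f 2) :
    cft f =ᵐ[volume] cftIntegral f :=
  (cft_ae_eq_fourierLp hn hf).trans (fourierLp_ae_eq_cftIntegral hn h1 hf)

lemma cft_sub (hf : MemLp f 2) (hg : MemLp g 2) : cft (f - g) =ᵐ[volume] cft f - cft g :=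
  (cft_ae_eq_fourierLp hn (hf.sub hg)).trans <| (fourierLp_sub hn hf hg).trans <|
    ((cft_ae_eq_fourierLp hn hf).sub (cft_ae_eq_fourierLp hn hg)).symm

lemma eLpNorm_cftIntegral_sub_cft (hf : MemLp f 2) (h1 : Integrable g) (hg : MemLp g 2) :
    eLpNorm (cftIntegral g - cft f) 2 volume =
      ENNReal.ofReal ((2 * Real.pi) ^ ((n : ℝ) / 2)) * eLpNorm (g - f) 2 volume := by
  rw [← eLpNorm_cftIntegral_sub_fourierLp hn hf h1 hg]
  exact eLpNorm_congr_ae ((ae_eq_refl _).sub (cft_ae_eq_fourierLp hn hf))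

lemma eLpNorm_cft (hf : MemLp f 2) : eLpNorm (cft f) 2 volume =
    ENNReal.ofReal ((2 * Real.pi) ^ ((n : ℝ) / 2)) * eLpNorm f 2 volume := by
  rw [eLpNorm_congr_ae (cft_ae_eq_fourierLp hn hf), eLpNorm_fourierLp hn hf]

lemma normSq_cft (hf : MemLp f 2) :
    normSq volume (cft f) = ENNReal.ofReal ((2 * Real.pi) ^ n) * normSq volume f := by
  rw [normSq_eq_eLpNorm_sq, normSq_eq_eLpNorm_sq, eLpNorm_cft hn hf, mul_pow,
    ← ENNReal.ofReal_pow (by positivity), sq, rpow_half_mul_self Real.two_pi_pos]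

/-- Operators that correspond under the Clifford Fourier integral and are bounded on `L²`
correspond under the Clifford Fourier transform, because both extend by continuity from the
truncations of `f`. -/
lemma cft_intertwine {S T : (E n → Cl n) → E n → Cl n} {C D : ENNReal} (hC : C ≠ ⊤) (hD : D ≠ ⊤)
    (hS_sub : ∀ u v, S (u - v) = S u - S v) (hT_sub : ∀ u v, T (u - v) = T u - T v)
    (hS_meas : ∀ u, AEStronglyMeasurable u → AEStronglyMeasurable (S u))
    (hT_meas : ∀ u, AEStronglyMeasurable u → AEStronglyMeasurable (T u))
    (hS_le : ∀ u, eLpNorm (S u) 2 volume ≤ C * eLpNorm u 2 volume)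
    (hT_le : ∀ u, eLpNorm (T u) 2 volume ≤ D * eLpNorm u 2 volume)
    (hS_int : ∀ u, Integrable u → Integrable (S u))
    (hST : ∀ u, Integrable u → cftIntegral (S u) = T (cftIntegral u)) (hf : MemLp f 2) :
    cft (S f) =ᵐ[volume] T (cft f) := by
  have hS_memLp : ∀ u, MemLp u 2 → MemLp (S u) 2 := fun u hu =>
    ⟨hS_meas u hu.1, (hS_le u).trans_lt (ENNReal.mul_lt_top hC.lt_top hu.2)⟩
  have h_int := fun R => integrable_trunc (o := (0 : E n)) one_le_two hf R
  have h_meas := fun R => (continuous_cftIntegral hn (h_int R)).aestronglyMeasurable (μ := volume)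
  refine ae_eq_of_tendsto_eLpNorm_sub one_le_two (l := atTop)
    (u := fun R => T (cftIntegral (trunc 0 f R))) (fun R => hT_meas _ (h_meas R))
    (memLp_cft hn (hS_memLp f hf)).1 (hT_meas _ (memLp_cft hn hf).1) ?_ ?_
  · simp_rw [← hST _ (h_int _), eLpNorm_cftIntegral_sub_cft hn (hS_memLp f hf)
      (hS_int _ (h_int _)) (hS_memLp _ (memLp_trunc hf _)), ← hS_sub]
    have h_S : Tendsto (fun R => eLpNorm (S (trunc 0 f R - f)) 2 volume) atTop (𝓝 0) := by
      refine tendsto_of_tendsto_of_tendsto_of_le_of_le tendsto_const_nhds ?_ (fun _ => zero_le)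
        fun R => hS_le (trunc 0 f R - f)
      simpa using ENNReal.Tendsto.const_mul (tendsto_eLpNorm_trunc_sub hf) (Or.inr hC)
    simpa using ENNReal.Tendsto.const_mul h_S (Or.inr ENNReal.ofReal_ne_top)
  · refine tendsto_of_tendsto_of_tendsto_of_le_of_le tendsto_const_nhds ?_ (fun _ => zero_le)
      fun R => (hT_sub _ _ ▸ hT_le (cftIntegral (trunc 0 f R) - cft f))
    simpa using ENNReal.Tendsto.const_mul (isCFT_iff.1 (isCFT_cft hn hf)).2 (Or.inr hD)

end FourierTransform

section Intertwining

variable {n : ℕ} {a : ℝ}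

lemma map_mul_expI {L : Cl n →L[ℝ] Cl n}
    (hL : ∀ M, L (M * pseudoscalar n) = L M * pseudoscalar n) (M : Cl n) (t : ℝ) :
    L (M * expI n t) = L M * expI n t := by
  simp only [expI, mul_add, ← Algebra.commutes, ← Algebra.smul_def, mul_smul_comm, map_add,
    map_smul, hL]

lemma daughter_inv_zero (u : E n → Cl n) (ha : 0 ≤ a) (r : SO n) (ω : E n) :
    daughter u a⁻¹ r 0 ω = a ^ ((n : ℝ) / 2) • u (a • rot r⁻¹ ω) := by
  rw [daughter_apply, smul_rot_inv_eq_simInv, Real.inv_rpow ha, inv_inv]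

variable (hn : n % 4 = 2 ∨ n % 4 = 3) {u f g : E n → Cl n}

include hn

lemma cftIntegral_continuousLinearMap_comp {L : Cl n →L[ℝ] Cl n}
    (hL : ∀ M, L (M * pseudoscalar n) = L M * pseudoscalar n) (hu : Integrable u) :
    cftIntegral (L ∘ u) = L ∘ cftIntegral u := by
  ext ω
  have hLu : Integrable (L ∘ u) := L.integrable_comp hu
  rw [cftIntegral_eq_integral hn hLu, Function.comp_apply,
    cftIntegral_eq_integral hn hu, ← L.integral_comp_comm (integrable_mul_expI hn hu ω)]
  simp_rw [map_mul_expI hL, Function.comp_apply]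

lemma cft_continuousLinearMap_comp {L : Cl n →L[ℝ] Cl n}
    (hL : ∀ M, L (M * pseudoscalar n) = L M * pseudoscalar n) (hf : MemLp f 2) :
    cft (L ∘ f) =ᵐ[volume] L ∘ cft f := by
  have hL_sub : ∀ u v : E n → Cl n, L ∘ (u - v) = L ∘ u - L ∘ v := fun u v =>
    funext fun x => map_sub L (u x) (v x)
  have hL_meas : ∀ u : E n → Cl n, AEStronglyMeasurable u → AEStronglyMeasurable (L ∘ u) :=
    fun u hu => L.continuous.comp_aestronglyMeasurable hu
  have hL_le : ∀ u : E n → Cl n, eLpNorm (L ∘ u) 2 volume ≤ ‖L‖ₑ * eLpNorm u 2 volume := fun u =>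
    eLpNorm_le_nnreal_smul_eLpNorm_of_ae_le_mul (ae_of_all _ fun x => L.le_opNNNorm (u x)) 2
  exact cft_intertwine hn enorm_ne_top enorm_ne_top hL_sub hL_sub hL_meas hL_meas hL_le hL_le
    (fun u hu => L.integrable_comp hu)
    (fun u hu => cftIntegral_continuousLinearMap_comp hn hL hu) hf

lemma cftIntegral_daughter (hu : Integrable u) (ha : 0 < a) (r : SO n) (b : E n) :
    cftIntegral (daughter u a r b) =
      fun ω => daughter (cftIntegral u) a⁻¹ r 0 ω * expI n (-(inner ℝ ω b)) := by
  ext ω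
  have h_phase : ∀ x, daughter u a r b x * expI n (-(inner ℝ ω x)) =
      daughter (fun y => u y * expI n (-(inner ℝ (a • rot r⁻¹ ω) y)) * expI n (-(inner ℝ ω b)))
        a r b x := fun x => by
    rw [daughter_apply, daughter_apply, inner_eq_inner_simInv_add ha.ne' r b ω x, neg_add,
      expI_add hn, smul_mul_assoc, mul_assoc]
  rw [cftIntegral_eq_integral hn (integrable_daughter hu ha r b), integral_congr_ae
    (ae_of_all _ h_phase), integral_daughter _ ha, daughter_inv_zero _ ha.le,
    cftIntegral_eq_integral hn hu, smul_mul_assoc]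
  exact congr_arg _ (((mulL n).flip (expI n (-(inner ℝ ω b)))).integral_comp_comm
    (integrable_mul_expI hn hu _))

lemma cft_daughter (hf : MemLp f 2) (ha : 0 < a) (r : SO n) (b : E n) :
    cft (daughter f a r b) =ᵐ[volume]
      fun ω => daughter (cft f) a⁻¹ r 0 ω * expI n (-(inner ℝ ω b)) := by
  refine cft_intertwine hn (S := fun u => daughter u a r b)
    (T := fun u ω => daughter u a⁻¹ r 0 ω * expI n (-(inner ℝ ω b)))
    ENNReal.one_ne_top ENNReal.one_ne_top (fun u v => daughter_sub u v a r b)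
    (fun u v => ?_) (fun u hu => aestronglyMeasurable_daughter hu ha r b)
    (fun u hu => (aestronglyMeasurable_daughter hu (inv_pos.2 ha) r 0).mul (by fun_prop))
    (fun u => ?_) (fun u => ?_) (fun u hu => integrable_daughter hu ha r b)
    (fun u hu => cftIntegral_daughter hn hu ha r b) hf
  · ext ω
    simp only [daughter_sub, Pi.sub_apply, sub_mul]
  · rw [eLpNorm_daughter u ha, one_mul]
  · rw [eLpNorm_congr_norm_ae (ae_of_all _ fun ω => norm_mul_expI hn _ _),
      eLpNorm_daughter u (inv_pos.2 ha), one_mul]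

lemma integral_norm_cft_sq (hf : MemLp f 2) :
    ∫ ω, ‖cft f ω‖ ^ 2 = (2 * Real.pi) ^ n * ∫ x, ‖f x‖ ^ 2 := by
  rw [integral_norm_sq_eq (memLp_cft hn hf).1, integral_norm_sq_eq hf.1,
    ← normSq_eq_eLpNorm_sq, ← normSq_eq_eLpNorm_sq, normSq_cft hn hf, ENNReal.toReal_mul,
    ENNReal.toReal_ofReal (by positivity)]

lemma integral_inner_cft (hf : MemLp f 2) (hg : MemLp g 2) :
    ∫ ω, inner ℝ (cft f ω) (cft g ω) = (2 * Real.pi) ^ n * ∫ x, inner ℝ (f x) (g x) := by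
  have h_sub : ∫ ω, ‖cft f ω - cft g ω‖ ^ 2 = ∫ ω, ‖cft (f - g) ω‖ ^ 2 :=
    integral_congr_ae <| (cft_sub hn hf hg).mono fun ω hω => by
      dsimp only
      rw [hω, Pi.sub_apply]
  rw [integral_norm_cft_sq hn (hf.sub hg), integral_norm_sub_sq (memLp_cft hn hf) (memLp_cft hn hg),
    integral_norm_cft_sq hn hf, integral_norm_cft_sq hn hg] at h_sub
  simp only [Pi.sub_apply, integral_norm_sub_sq hf hg] at h_sub
  linarith

lemma integral_cft_mul_rev_cft (hf : MemLp f 2) (hg : MemLp g 2) :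
    ∫ ω, cft f ω * rev (cft g ω) = (2 * Real.pi) ^ n • ∫ x, f x * rev (g x) := by
  have h_int_cft := integrable_mul_of_memLp (memLp_cft hn hf) (memLp_rev (memLp_cft hn hg))
  have h_int := integrable_mul_of_memLp hf (memLp_rev hg)
  have h_inner : ∀ A : Finset (Fin n), ∀ M N : Cl n,
      inner ℝ (blade A) (M * rev N) = inner ℝ M (blade A * N) := fun A M N => by
    rw [real_inner_comm, inner_mul_right_eq, rev_rev]
  refine InnerProductSpace.ext_inner_left_basis (bladeBasis n).toBasis fun A => ?_
  rw [OrthonormalBasis.coe_toBasis, bladeBasis_apply, inner_smul_right, ← integral_inner h_int_cft,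
    ← integral_inner h_int]
  simp_rw [h_inner]
  have h_cft : cft (mulL n (blade A) ∘ g) =ᵐ[volume] mulL n (blade A) ∘ cft g :=
    cft_continuousLinearMap_comp hn (fun M => (mul_assoc (blade A) M (pseudoscalar n)).symm) hg
  have h_parseval := integral_inner_cft hn hf ((mulL n (blade A)).comp_memLp' hg)
  rw [integral_congr_ae (h_cft.mono fun ω hω => congr_arg (inner ℝ (cft f ω)) hω)] at h_parseval
  exact h_parseval

end Intertwining

/-! ### The wavelet transform on the Fourier side -/

section WaveletTransform

variable {n : ℕ} {σ : ℤˣ} {u ψ f g : E n → Cl n} {p : ℝ × SO n}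

lemma exists_pseudoscalar_mul_eq (hn : n % 4 = 2 ∨ n % 4 = 3)
    (hψ : n % 4 = 2 → (∀ᵐ x, ψ x ∈ CliffordAlgebra.evenOdd (euclideanForm n) 0) ∨
      (∀ᵐ x, ψ x ∈ CliffordAlgebra.evenOdd (euclideanForm n) 1)) :
    ∃ σ : ℤˣ, ∀ᵐ x, pseudoscalar n * ψ x = σ • (ψ x * pseudoscalar n) := by
  rcases hn with hn | hn
  · have h_even : Even n := Nat.even_iff.2 (by omega)
    rcases hψ hn with h_mem | h_mem
    · refine ⟨1, h_mem.mono fun x hx => ?_⟩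
      rw [pseudoscalar_mul_of_even h_even (by omega), CliffordAlgebra.involute_eq_of_mem_even hx,
        one_smul]
    · refine ⟨-1, h_mem.mono fun x hx => ?_⟩
      rw [pseudoscalar_mul_of_even h_even (by omega), CliffordAlgebra.involute_eq_of_mem_odd hx,
        Units.neg_smul, one_smul, neg_mul]
  · exact ⟨1, ae_of_all _ fun x => by rw [pseudoscalar_mul_of_odd (by omega), one_smul]⟩

lemma mul_expI_of_pseudoscalar_mul {M : Cl n}
    (hM : pseudoscalar n * M = σ • (M * pseudoscalar n)) (t : ℝ) :
    M * expI n t = expI n (σ • t) * M := by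
  rcases Int.units_eq_one_or σ with rfl | rfl
  · rw [one_smul] at hM
    rw [one_smul, expI, mul_add, add_mul, mul_smul_comm, smul_mul_assoc, hM, Algebra.commutes]
  · rw [Units.neg_smul, one_smul] at hM
    rw [Units.neg_smul, one_smul, expI, expI, mul_add, add_mul, mul_smul_comm, smul_mul_assoc, hM,
      Real.cos_neg, Real.sin_neg, neg_smul_neg, Algebra.commutes]

lemma pseudoscalar_mul_daughter {a : ℝ} (ha : 0 < a) (r : SO n) (b : E n)
    (hu : ∀ᵐ x, pseudoscalar n * u x = σ • (u x * pseudoscalar n)) :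
    ∀ᵐ x, pseudoscalar n * daughter u a r b x = σ • (daughter u a r b x * pseudoscalar n) := by
  filter_upwards [(quasiMeasurePreserving_simInv ha r b).ae hu] with x hx
  rw [daughter_apply, mul_smul_comm, hx, smul_mul_assoc, smul_comm]

/-- The Fourier transform of the wavelet transform of `f` in the translation variable, at the
dilation `p.1` and the rotation `p.2`, up to the factor `(2π)ⁿ` and a reflection. -/
def waveletSymbol (ψ f : E n → Cl n) (p : ℝ × SO n) (ω : E n) : Cl n :=
  cft f ω * rev (daughter (cft ψ) p.1⁻¹ p.2 0 ω)

lemma waveletTransform_eq_integral (hψ : MemLp ψ 2) (hf : MemLp f 2) (hp : 0 < p.1) (b : E n) :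
    waveletTransform ψ f (p, b) = ∫ x, f x * rev (daughter ψ p.1 p.2 b x) :=
  clIntegral_eq_integral (integrable_mul_of_memLp hf (memLp_rev (memLp_daughter hψ hp _ _)))

lemma waveletTransform_sub (hψ : MemLp ψ 2) (hf : MemLp f 2) (hg : MemLp g 2) (hp : 0 < p.1)
    (b : E n) :
    waveletTransform ψ (f - g) (p, b) =
      waveletTransform ψ f (p, b) - waveletTransform ψ g (p, b) := by
  have h_rev := memLp_rev (memLp_daughter hψ hp p.2 b)
  rw [waveletTransform_eq_integral hψ hf hp, waveletTransform_eq_integral hψ hg hp,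
    waveletTransform_eq_integral hψ (hf.sub hg) hp,
    ← integral_sub (integrable_mul_of_memLp hf h_rev) (integrable_mul_of_memLp hg h_rev)]
  simp only [Pi.sub_apply, sub_mul]

lemma waveletTransform_add_right (ψ f : E n → Cl n) (p : ℝ × SO n) (b v : E n) :
    waveletTransform ψ f (p, b + v) = waveletTransform ψ (fun x => f (x + v)) (p, b) := by
  unfold waveletTransform clIntegral
  refine Finset.sum_congr rfl fun A _ => congr_arg (· • blade A) ?_
  rw [← integral_add_right_eq_self (μ := volume) _ v]
  simp only [daughter, add_sub_add_right_eq_sub]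

lemma norm_waveletSymbol_sq (hp : 0 < p.1) (ω : E n) :
    ‖waveletSymbol ψ f p ω‖ ^ 2 =
      inner ℝ (cft f ω) (cft f ω * admissibilityIntegrand ψ ω p) := by
  rw [← real_inner_self_eq_norm_sq, waveletSymbol, daughter_inv_zero _ hp.le, inner_mul_right_eq,
    rev_rev, mul_assoc, rev_smul, smul_mul_smul_comm, rpow_half_mul_self hp,
    admissibilityIntegrand]

variable (hn : n % 4 = 2 ∨ n % 4 = 3)

include hn

lemma rev_mul_expI {M : Cl n} (hM : pseudoscalar n * M = σ • (M * pseudoscalar n)) (t : ℝ) :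
    rev (M * expI n t) = rev M * expI n (-(σ • t)) := by
  rw [mul_expI_of_pseudoscalar_mul hM, rev_mul, rev_expI hn]

lemma pseudoscalar_mul_cft (hf : MemLp f 2)
    (h : ∀ᵐ x, pseudoscalar n * f x = σ • (f x * pseudoscalar n)) :
    ∀ᵐ ω, pseudoscalar n * cft f ω = σ • (cft f ω * pseudoscalar n) := by
  have h_left : cft (mulL n (pseudoscalar n) ∘ f) =ᵐ[volume] mulL n (pseudoscalar n) ∘ cft f :=
    cft_continuousLinearMap_comp hn (fun M => (mul_assoc _ M _).symm) hf
  have h_right := cft_continuousLinearMap_comp hn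
    (L := σ • (mulL n).flip (pseudoscalar n)) (fun M => (smul_mul_assoc σ _ _).symm) hf
  have h_congr : cft (mulL n (pseudoscalar n) ∘ f) =
      cft ((σ • (mulL n).flip (pseudoscalar n) : Cl n →L[ℝ] Cl n) ∘ f) := cft_congr_ae h
  rw [h_congr] at h_left
  exact h_left.symm.trans h_right

lemma integrable_waveletSymbol (hψ : MemLp ψ 2) (hf : MemLp f 2) (hp : 0 < p.1) :
    Integrable (waveletSymbol ψ f p) :=
  integrable_mul_of_memLp (memLp_cft hn hf)
    (memLp_rev (memLp_daughter (memLp_cft hn hψ) (inv_pos.2 hp) p.2 0))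

lemma waveletTransform_eq_cftIntegral (hψ : MemLp ψ 2)
    (hσ : ∀ᵐ x, pseudoscalar n * ψ x = σ • (ψ x * pseudoscalar n)) (hf : MemLp f 2)
    (hp : 0 < p.1) (b : E n) :
    waveletTransform ψ f (p, b) =
      ((2 * Real.pi) ^ n)⁻¹ • cftIntegral (waveletSymbol ψ f p) (-(σ • b)) := by
  have h_symbol := pseudoscalar_mul_daughter (inv_pos.2 hp) p.2 0 (pseudoscalar_mul_cft hn hψ hσ)
  rw [waveletTransform_eq_integral hψ hf hp, eq_inv_smul_iff₀ (by positivity),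
    ← integral_cft_mul_rev_cft hn hf (memLp_daughter hψ hp _ _),
    cftIntegral_eq_integral hn (integrable_waveletSymbol hn hψ hf hp)]
  refine integral_congr_ae ?_
  filter_upwards [cft_daughter hn hψ hp p.2 b, h_symbol] with ω h_cft hω
  have h_phase : inner ℝ (-(σ • b)) ω = σ • -inner ℝ ω b := by
    rcases Int.units_eq_one_or σ with rfl | rfl <;> simp [real_inner_comm]
  rw [h_cft, rev_mul_expI hn hω, waveletSymbol, mul_assoc, h_phase]

lemma normSq_waveletTransform_section (hψ : MemLp ψ 2)
    (hσ : ∀ᵐ x, pseudoscalar n * ψ x = σ • (ψ x * pseudoscalar n)) (hf : MemLp f 2)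
    (hp : 0 < p.1) (hs : MemLp (waveletSymbol ψ f p) 2) :
    normSq volume (fun b => waveletTransform ψ f (p, b)) =
      ENNReal.ofReal ((2 * Real.pi) ^ n)⁻¹ * normSq volume (waveletSymbol ψ f p) := by
  have h_reflect : normSq volume (fun b => cftIntegral (waveletSymbol ψ f p) (-(σ • b))) =
      normSq volume (cftIntegral (waveletSymbol ψ f p)) := by
    rcases Int.units_eq_one_or σ with rfl | rfl
    · simp_rw [normSq_eq_lintegral, one_smul]
      exact lintegral_neg_eq_self (fun b => ‖cftIntegral (waveletSymbol ψ f p) b‖ₑ ^ 2)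
    · simp only [Units.neg_smul, one_smul, neg_neg]
  have h_const : (((2 * Real.pi) ^ n)⁻¹) ^ 2 * (2 * Real.pi) ^ n = ((2 * Real.pi) ^ n)⁻¹ := by
    rw [sq, mul_assoc, inv_mul_cancel₀ (by positivity), mul_one]
  simp_rw [waveletTransform_eq_cftIntegral hn hψ hσ hf hp]
  rw [normSq_const_smul, h_reflect,
    ← normSq_congr_ae (cft_ae_eq_cftIntegral hn (integrable_waveletSymbol hn hψ hf hp) hs),
    normSq_cft hn hs, ← mul_assoc, ← ENNReal.ofReal_mul (by positivity), h_const]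

end WaveletTransform

/-! ### The wavelet transform on the similitude group -/

section SimilitudeGroup

variable {n : ℕ} {u ψ f : E n → Cl n}

section Joint

variable {α : Type*} [MeasurableSpace α] {μ : Measure α} {a : α → ℝ} {r : α → SO n} {b : α → E n}

lemma measurable_simInv (ha : Measurable a) (hr : Measurable r) (hb : Measurable b) :
    Measurable fun q : α × E n => simInv (a q.1) (r q.1) (b q.1) q.2 := by
  have h_inv : Measurable fun q : α × E n => (r q.1)⁻¹ :=
    continuous_inv_SO.measurable.comp (hr.comp measurable_fst)
  have h_dil : Measurable fun q : α × E n => (a q.1)⁻¹ • (q.2 - b q.1) :=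
    (ha.comp measurable_fst).inv.smul (measurable_snd.sub (hb.comp measurable_fst))
  have h_rot := (continuous_rot (n := n)).measurable.comp (h_inv.prodMk h_dil)
  exact h_rot

lemma aestronglyMeasurable_daughter_prod (hu : AEStronglyMeasurable u)
    (ha : Measurable a) (hr : Measurable r) (hb : Measurable b) (h_pos : ∀ᵐ x ∂μ, 0 < a x) :
    AEStronglyMeasurable (fun q : α × E n => daughter u (a q.1) (r q.1) (b q.1) q.2)
      (μ.prod volume) := by
  have h_qmp : Measure.QuasiMeasurePreserving
      (fun q : α × E n => simInv (a q.1) (r q.1) (b q.1) q.2) (μ.prod volume) volume :=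
    QuasiMeasurePreserving.prod_of_right (measurable_simInv ha hr hb)
      (h_pos.mono fun x hx => quasiMeasurePreserving_simInv hx (r x) (b x))
  have h_coeff : Measurable fun q : α × E n => 1 / a q.1 ^ ((n : ℝ) / 2) := by fun_prop
  exact h_coeff.aestronglyMeasurable.smul (hu.comp_quasiMeasurePreserving h_qmp)

end Joint

variable {ν : Measure (SO n)}

lemma ae_dilRotMeasure_pos : ∀ᵐ p ∂(dilRotMeasure ν), 0 < p.1 :=
  Measure.quasiMeasurePreserving_fst.ae <|
    (withDensity_absolutelyContinuous _ _).ae_le (ae_restrict_mem measurableSet_Ioi)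

lemma ae_simMeasure_pos : ∀ᵐ p ∂(simMeasure ν), 0 < p.1.1 :=
  Measure.quasiMeasurePreserving_fst.ae ae_dilRotMeasure_pos

instance instSFiniteDilRotMeasure [SFinite ν] : SFinite (dilRotMeasure ν) := by
  unfold dilRotMeasure
  infer_instance

lemma aestronglyMeasurable_waveletTransform (hψ : MemLp ψ 2) (hf : MemLp f 2) :
    AEStronglyMeasurable (waveletTransform ψ f) (simMeasure ν) := by
  have h_daughter := aestronglyMeasurable_daughter_prod hψ.1
    (a := fun p : (ℝ × SO n) × E n => p.1.1) (by fun_prop) (r := fun p => p.1.2) (by fun_prop)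
    measurable_snd (ae_simMeasure_pos (ν := ν))
  have h_integrand := (hf.1.comp_quasiMeasurePreserving
    (Measure.quasiMeasurePreserving_snd (μ := simMeasure ν))).mul
    (continuous_rev.comp_aestronglyMeasurable h_daughter)
  refine h_integrand.integral_prod_right'.congr ?_
  filter_upwards [ae_simMeasure_pos] with p hp
  exact (waveletTransform_eq_integral hψ hf hp p.2).symm

lemma lintegral_enorm_waveletSymbol_sq {c : ℝ} {ω : E n}
    (h_int : ClIntegrable (dilRotMeasure ν) (admissibilityIntegrand ψ ω))
    (h_const : clIntegral (dilRotMeasure ν) (admissibilityIntegrand ψ ω) =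
      algebraMap ℝ (Cl n) c) :
    ∫⁻ p, ‖waveletSymbol ψ f p ω‖ₑ ^ 2 ∂(dilRotMeasure ν) =
      ENNReal.ofReal c * ‖cft f ω‖ₑ ^ 2 := by
  rw [clIntegrable_iff] at h_int
  rw [clIntegral_eq_integral h_int] at h_const
  set ℓ : Cl n →L[ℝ] ℝ := (innerSL ℝ (cft f ω)).comp (mulL n (cft f ω))
  have h_sq : (fun p => ‖waveletSymbol ψ f p ω‖ ^ 2) =ᵐ[dilRotMeasure ν]
      fun p => ℓ (admissibilityIntegrand ψ ω p) :=
    ae_dilRotMeasure_pos.mono fun p hp => norm_waveletSymbol_sq hp ω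
  have h_value : ∫ p, ‖waveletSymbol ψ f p ω‖ ^ 2 ∂(dilRotMeasure ν) = c * ‖cft f ω‖ ^ 2 := by
    rw [integral_congr_ae h_sq, ℓ.integral_comp_comm h_int, h_const]
    change inner ℝ (cft f ω) (cft f ω * algebraMap ℝ (Cl n) c) = _
    rw [← Algebra.commutes, ← Algebra.smul_def, inner_smul_right, real_inner_self_eq_norm_sq]
  simp_rw [← ofReal_norm, ← ENNReal.ofReal_pow (norm_nonneg _)]
  rw [← ofReal_integral_eq_lintegral_ofReal ((ℓ.integrable_comp h_int).congr h_sq.symm)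
    (ae_of_all _ fun p => sq_nonneg _), h_value, ENNReal.ofReal_mul' (sq_nonneg _)]

variable (hn : n % 4 = 2 ∨ n % 4 = 3) {c : ℝ}

include hn

lemma aestronglyMeasurable_waveletSymbol (hψ : MemLp ψ 2) (hf : MemLp f 2) :
    AEStronglyMeasurable (fun q : (ℝ × SO n) × E n => waveletSymbol ψ f q.1 q.2)
      ((dilRotMeasure ν).prod volume) := by
  have h_daughter := aestronglyMeasurable_daughter_prod (memLp_cft hn hψ).1
    (a := fun p : ℝ × SO n => p.1⁻¹) (by fun_prop) measurable_snd (b := 0)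
    measurable_const ((ae_dilRotMeasure_pos (ν := ν)).mono fun p hp => inv_pos.2 hp)
  exact ((memLp_cft hn hf).1.comp_quasiMeasurePreserving Measure.quasiMeasurePreserving_snd).mul
    (continuous_rev.comp_aestronglyMeasurable h_daughter)

variable [SFinite ν]

lemma lintegral_normSq_waveletSymbol (hψ : IsAdmissible ν ψ (algebraMap ℝ (Cl n) c))
    (hf : MemLp f 2) :
    ∫⁻ p, normSq volume (waveletSymbol ψ f p) ∂(dilRotMeasure ν) =
      ENNReal.ofReal c * normSq volume (cft f) := by
  have h_meas := aestronglyMeasurable_waveletSymbol (ν := ν) hn (memL2_iff.1 hψ.memL2) hf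
  simp_rw [normSq_eq_lintegral]
  rw [lintegral_lintegral_swap (h_meas.enorm.pow_const 2), ← lintegral_const_mul'' _
    ((memLp_cft hn hf).1.enorm.pow_const 2)]
  exact lintegral_congr_ae <| hψ.finite_const.mono fun ω hω =>
    lintegral_enorm_waveletSymbol_sq hω.1 hω.2

lemma ae_memLp_waveletSymbol (hψ : IsAdmissible ν ψ (algebraMap ℝ (Cl n) c)) (hf : MemLp f 2) :
    ∀ᵐ p ∂(dilRotMeasure ν), MemLp (waveletSymbol ψ f p) 2 := by
  have hψ2 : MemLp ψ 2 := memL2_iff.1 hψ.memL2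
  have h_meas : AEMeasurable (fun p => normSq volume (waveletSymbol ψ f p)) (dilRotMeasure ν) := by
    simp_rw [normSq_eq_lintegral]
    exact ((aestronglyMeasurable_waveletSymbol hn hψ2 hf).enorm.pow_const 2).lintegral_prod_right'
  have h_total : ∫⁻ p, normSq volume (waveletSymbol ψ f p) ∂(dilRotMeasure ν) ≠ ⊤ := by
    rw [lintegral_normSq_waveletSymbol hn hψ hf]
    exact ENNReal.mul_ne_top ENNReal.ofReal_ne_top (memL2_iff.2 (memLp_cft hn hf)).2.ne
  filter_upwards [ae_lt_top' h_meas h_total, ae_dilRotMeasure_pos] with p h_fin hp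
  exact memL2_iff.1 ⟨aestronglyMeasurable_iff_coeff.1
    (integrable_waveletSymbol hn hψ2 hf hp).1, h_fin⟩

theorem normSq_waveletTransform (hψ : IsAdmissible ν ψ (algebraMap ℝ (Cl n) c))
    (hf : MemLp f 2) :
    normSq (simMeasure ν) (waveletTransform ψ f) = ENNReal.ofReal c * normSq volume f := by
  have hψ2 : MemLp ψ 2 := memL2_iff.1 hψ.memL2
  obtain ⟨σ, hσ⟩ := exists_pseudoscalar_mul_eq hn hψ.parity
  have h_section : ∀ᵐ p ∂(dilRotMeasure ν), normSq volume (fun b => waveletTransform ψ f (p, b)) =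
      ENNReal.ofReal ((2 * Real.pi) ^ n)⁻¹ * normSq volume (waveletSymbol ψ f p) := by
    filter_upwards [ae_memLp_waveletSymbol hn hψ hf, ae_dilRotMeasure_pos] with p hs hp
    exact normSq_waveletTransform_section hn hψ2 hσ hf hp hs
  calc normSq (simMeasure ν) (waveletTransform ψ f)
      = ∫⁻ p, normSq volume (fun b => waveletTransform ψ f (p, b)) ∂(dilRotMeasure ν) := by
        simp_rw [normSq_eq_lintegral]
        exact lintegral_prod _
          ((aestronglyMeasurable_waveletTransform hψ2 hf).enorm.pow_const 2)
    _ = ENNReal.ofReal ((2 * Real.pi) ^ n)⁻¹ *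
          ∫⁻ p, normSq volume (waveletSymbol ψ f p) ∂(dilRotMeasure ν) := by
        rw [lintegral_congr_ae h_section, lintegral_const_mul' _ _ ENNReal.ofReal_ne_top]
    _ = ENNReal.ofReal c * normSq volume f := by
        rw [lintegral_normSq_waveletSymbol hn hψ hf, normSq_cft hn hf, mul_left_comm,
          ← mul_assoc (ENNReal.ofReal _⁻¹), ← ENNReal.ofReal_mul (by positivity),
          inv_mul_cancel₀ (by positivity), ENNReal.ofReal_one, one_mul]

end SimilitudeGroup

/-! ### Translations -/

section Translation

variable {n : ℕ} {f : E n → Cl n} (hn : n % 4 = 2 ∨ n % 4 = 3)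

lemma memLp_translate (hf : MemLp f 2) (v : E n) : MemLp (fun x => f (x + v)) 2 :=
  hf.comp_measurePreserving (measurePreserving_add_right volume v)

include hn

lemma cft_translate (hf : MemLp f 2) (v : E n) :
    cft (fun x => f (x + v)) =ᵐ[volume] fun ω => cft f ω * expI n (inner ℝ ω v) := by
  have h_daughter : daughter f 1 1 (-v) = fun x => f (x + v) := by
    ext x
    simp [daughter, rot_one]
  filter_upwards [h_daughter ▸ cft_daughter hn hf one_pos 1 (-v)] with ω hω
  simp [hω, daughter, rot_one]

lemma normSq_translate_sub_le (hf : MemLp f 2) (v w : E n) :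
    normSq volume ((fun x => f (x + v)) - fun x => f (x + w)) ≤
      ENNReal.ofReal ((2 * Real.pi) ^ n)⁻¹ *
        normSq volume (fun ω => inner ℝ ω (v - w) • cft f ω) := by
  have hv := memLp_translate hf v
  have hw := memLp_translate hf w
  rw [← one_mul (normSq volume (_ - _)), ← ENNReal.ofReal_one,
    ← inv_mul_cancel₀ (a := (2 * Real.pi) ^ n) (by positivity),
    ENNReal.ofReal_mul (by positivity), mul_assoc, ← normSq_cft hn (hv.sub hw),
    normSq_eq_lintegral, normSq_eq_lintegral]
  gcongr ENNReal.ofReal _ * ?_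
  refine lintegral_mono_ae ?_
  filter_upwards [cft_sub hn hv hw, cft_translate hn hf v, cft_translate hn hf w]
    with ω h_sub h_v h_w
  rw [h_sub, Pi.sub_apply, h_v, h_w, inner_sub_right]
  gcongr
  exact enorm_le_iff_norm_le.2 (norm_mul_expI_sub_le hn _ _ _)

lemma normSq_waveletTransform_translate_sub_le {ν : Measure (SO n)} [SFinite ν] {ψ : E n → Cl n}
    {c : ℝ} (hψ : IsAdmissible ν ψ (algebraMap ℝ (Cl n) c)) (hf : MemLp f 2) (v w : E n) :
    normSq (simMeasure ν)
        (fun p => waveletTransform ψ f (p.1, p.2 + v) - waveletTransform ψ f (p.1, p.2 + w)) ≤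
      ENNReal.ofReal c * (ENNReal.ofReal ((2 * Real.pi) ^ n)⁻¹ *
        normSq volume (fun ω => inner ℝ ω (v - w) • cft f ω)) := by
  have hv := memLp_translate hf v
  have hw := memLp_translate hf w
  have h_sub : (fun p => waveletTransform ψ f (p.1, p.2 + v) - waveletTransform ψ f (p.1, p.2 + w))
      =ᵐ[simMeasure ν] waveletTransform ψ ((fun x => f (x + v)) - fun x => f (x + w)) := by
    filter_upwards [ae_simMeasure_pos] with p hp
    rw [waveletTransform_sub (memL2_iff.1 hψ.memL2) hv hw hp, waveletTransform_add_right,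
      waveletTransform_add_right]
  rw [normSq_congr_ae h_sub, normSq_waveletTransform hn hψ (hv.sub hw)]
  gcongr
  exact normSq_translate_sub_le hn hf v w

end Translation

/-! ### The uncertainty inequality for a flow -/

section Uncertainty

variable {X F : Type*} [MeasurableSpace X] {m : Measure X} [NormedAddCommGroup F]
  [InnerProductSpace ℝ F] {f g T : X → F} {q : X → ℝ}

lemma inner_toLp (hf : MemLp f 2 m) (hg : MemLp g 2 m) :
    inner ℝ (hf.toLp f) (hg.toLp g) = ∫ x, inner ℝ (f x) (g x) ∂m := by
  rw [L2.inner_def]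
  refine integral_congr_ae ?_
  filter_upwards [hf.coeFn_toLp, hg.coeFn_toLp] with x hfx hgx
  rw [hfx, hgx]

lemma sq_integral_inner_le (hf : MemLp f 2 m) (hg : MemLp g 2 m) :
    (∫ x, inner ℝ (f x) (g x) ∂m) ^ 2 ≤ (∫ x, ‖f x‖ ^ 2 ∂m) * ∫ x, ‖g x‖ ^ 2 ∂m := by
  have h := real_inner_mul_inner_self_le (hf.toLp f) (hg.toLp g)
  simp_rw [inner_toLp] at h
  simpa only [real_inner_self_eq_norm_sq, ← sq] using h

/-- The translation form of the canonical commutation relation: multiplication by `q` and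
composition with `τ` commute up to `t`. -/
lemma mul_integral_inner_comp {t : ℝ} (τ : X ≃ᵐ X) (hτ : MeasurePreserving τ m m)
    (hq : ∀ x, q (τ x) = q x + t) (hT : MemLp T 2 m) (hqT : MemLp (fun x => q x • T x) 2 m) :
    t * ∫ x, inner ℝ (T x) (T (τ x)) ∂m =
      ∫ x, inner ℝ (q x • T x) (T (τ.symm x) - T (τ x)) ∂m := by
  have h_comp : MemLp (fun x => T (τ x)) 2 m := hT.comp_measurePreserving hτ
  have h_comp_symm : MemLp (fun x => T (τ.symm x)) 2 m := hT.comp_measurePreserving hτ.symm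
  have h_int := integrable_inner_of_memLp hqT h_comp
  have h_shift : ∫ x, inner ℝ (q x • T x) (T (τ.symm x)) ∂m =
      ∫ x, inner ℝ (q x • T x) (T (τ x)) ∂m + t * ∫ x, inner ℝ (T x) (T (τ x)) ∂m := by
    rw [← hτ.integral_comp', ← integral_const_mul,
      ← integral_add h_int ((integrable_inner_of_memLp hT h_comp).const_mul t)]
    refine integral_congr_ae (ae_of_all _ fun x => ?_)
    simp only [MeasurableEquiv.symm_apply_apply, hq, real_inner_smul_left,
      real_inner_comm (T x) (T (τ x))]
    ring
  simp_rw [inner_sub_right]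
  rw [integral_sub (integrable_inner_of_memLp hqT h_comp_symm) h_int, h_shift, add_sub_cancel_left]

lemma integral_inner_comp_eq (τ : X ≃ᵐ X) (hτ : MeasurePreserving τ m m) (hT : MemLp T 2 m) :
    ∫ x, inner ℝ (T x) (T (τ x)) ∂m =
      ∫ x, ‖T x‖ ^ 2 ∂m - 2⁻¹ * ∫ x, ‖T x - T (τ x)‖ ^ 2 ∂m := by
  have h_sub := integral_norm_sub_sq hT (hT.comp_measurePreserving hτ)
  have h_comp : ∫ x, ‖T (τ x)‖ ^ 2 ∂m = ∫ x, ‖T x‖ ^ 2 ∂m := hτ.integral_comp' (fun x => ‖T x‖ ^ 2)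
  simp only [Function.comp_apply, h_comp] at h_sub
  rw [h_sub]
  ring

variable {τ : ℝ → X ≃ᵐ X}

lemma integral_norm_sq_sub_le_sqrt (hτ : ∀ t, MeasurePreserving (τ t) m m)
    (hτ_zero : ∀ x, τ 0 x = x) (hτ_symm : ∀ t x, (τ t).symm x = τ (-t) x)
    (hq : ∀ t x, q (τ t x) = q x + t) (hT : MemLp T 2 m) (hqT : MemLp (fun x => q x • T x) 2 m)
    {K : ℝ} (hK : ∀ s t, ∫ x, ‖T (τ s x) - T (τ t x)‖ ^ 2 ∂m ≤ (s - t) ^ 2 * K) {t : ℝ}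
    (ht : 0 < t) :
    ∫ x, ‖T x‖ ^ 2 ∂m - 2⁻¹ * (t ^ 2 * K) ≤ √(4 * (∫ x, ‖q x • T x‖ ^ 2 ∂m) * K) := by
  have h_comp : ∀ s, MemLp (fun x => T (τ s x)) 2 m := fun s => hT.comp_measurePreserving (hτ s)
  have h_cauchy := sq_integral_inner_le hqT ((h_comp (-t)).sub (h_comp t))
  have h_commute := mul_integral_inner_comp (τ t) (hτ t) (hq t) hT hqT
  simp only [hτ_symm] at h_commute
  simp only [Pi.sub_apply, ← h_commute] at h_cauchy
  have h_bound : t ^ 2 * (∫ x, inner ℝ (T x) (T (τ t x)) ∂m) ^ 2 ≤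
      t ^ 2 * (4 * (∫ x, ‖q x • T x‖ ^ 2 ∂m) * K) := by
    rw [← mul_pow]
    refine h_cauchy.trans ((mul_le_mul_of_nonneg_left (hK (-t) t)
      (integral_nonneg fun x => sq_nonneg _)).trans_eq ?_)
    ring
  have h_sqrt := Real.le_sqrt_of_sq_le (le_of_mul_le_mul_left h_bound (by positivity))
  have h_diff := hK 0 t
  simp only [hτ_zero, zero_sub, neg_sq] at h_diff
  linarith [integral_inner_comp_eq (τ t) (hτ t) hT]

theorem sq_integral_norm_sq_le (hτ : ∀ t, MeasurePreserving (τ t) m m)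
    (hτ_zero : ∀ x, τ 0 x = x) (hτ_symm : ∀ t x, (τ t).symm x = τ (-t) x)
    (hq : ∀ t x, q (τ t x) = q x + t) (hT : MemLp T 2 m) (hqT : MemLp (fun x => q x • T x) 2 m)
    {K : ℝ} (hK : ∀ s t, ∫ x, ‖T (τ s x) - T (τ t x)‖ ^ 2 ∂m ≤ (s - t) ^ 2 * K) :
    (∫ x, ‖T x‖ ^ 2 ∂m) ^ 2 ≤ 4 * (∫ x, ‖q x • T x‖ ^ 2 ∂m) * K := by
  have hK_nonneg : 0 ≤ K := by
    simpa using (integral_nonneg fun x => sq_nonneg ‖T (τ 1 x) - T (τ 0 x)‖).trans (hK 1 0)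
  have h_lim : Tendsto (fun t : ℝ => ∫ x, ‖T x‖ ^ 2 ∂m - 2⁻¹ * (t ^ 2 * K)) (𝓝[>] 0)
      (𝓝 (∫ x, ‖T x‖ ^ 2 ∂m)) := by
    have h_cont : ContinuousAt (fun t : ℝ => ∫ x, ‖T x‖ ^ 2 ∂m - 2⁻¹ * (t ^ 2 * K)) 0 := by
      fun_prop
    simpa using! h_cont.tendsto.mono_left nhdsWithin_le_nhds
  have h_le : ∫ x, ‖T x‖ ^ 2 ∂m ≤ √(4 * (∫ x, ‖q x • T x‖ ^ 2 ∂m) * K) :=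
    le_of_tendsto h_lim <| eventually_mem_nhdsWithin.mono fun t ht =>
      integral_norm_sq_sub_le_sqrt hτ hτ_zero hτ_symm hq hT hqT hK ht
  exact (Real.le_sqrt (by positivity) (by positivity)).1 h_le

theorem sq_lintegral_enorm_sq_le (hτ : ∀ t, MeasurePreserving (τ t) m m)
    (hτ_zero : ∀ x, τ 0 x = x) (hτ_symm : ∀ t x, (τ t).symm x = τ (-t) x)
    (hq : ∀ t x, q (τ t x) = q x + t) (hT : MemLp T 2 m) (hqT : MemLp (fun x => q x • T x) 2 m)
    {K : ENNReal} (hK_top : K ≠ ⊤) (hK : ∀ s t,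
      ∫⁻ x, ‖T (τ s x) - T (τ t x)‖ₑ ^ 2 ∂m ≤ ENNReal.ofReal ((s - t) ^ 2) * K) :
    (∫⁻ x, ‖T x‖ₑ ^ 2 ∂m) ^ 2 ≤ 4 * (∫⁻ x, ‖q x • T x‖ₑ ^ 2 ∂m) * K := by
  have hK_real : ∀ s t, ∫ x, ‖T (τ s x) - T (τ t x)‖ ^ 2 ∂m ≤ (s - t) ^ 2 * K.toReal := by
    intro s t
    have h_sub : MemLp (fun x => T (τ s x) - T (τ t x)) 2 m :=
      (hT.comp_measurePreserving (hτ s)).sub (hT.comp_measurePreserving (hτ t))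
    rw [← ENNReal.ofReal_le_ofReal_iff (by positivity), ← lintegral_enorm_sq_eq_ofReal h_sub,
      ENNReal.ofReal_mul (sq_nonneg _), ENNReal.ofReal_toReal hK_top]
    exact hK s t
  have h_real := sq_integral_norm_sq_le hτ hτ_zero hτ_symm hq hT hqT hK_real
  rw [lintegral_enorm_sq_eq_ofReal hT, lintegral_enorm_sq_eq_ofReal hqT,
    ← ENNReal.ofReal_pow (by positivity), ← ENNReal.ofReal_ofNat, ← ENNReal.ofReal_toReal hK_top,
    ← ENNReal.ofReal_mul (by positivity), ← ENNReal.ofReal_mul (by positivity)]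
  exact ENNReal.ofReal_le_ofReal h_real

end Uncertainty

/-! ### The uncertainty principle for the wavelet transform -/

section Main

variable {n : ℕ}

/-- Translation of the similitude group in its `ℝⁿ` component. -/
def simTranslate (v : E n) : ((ℝ × SO n) × E n) ≃ᵐ ((ℝ × SO n) × E n) :=
  (MeasurableEquiv.refl _).prodCongr (MeasurableEquiv.addRight v)

lemma simTranslate_apply (v : E n) (p : (ℝ × SO n) × E n) : simTranslate v p = (p.1, p.2 + v) := rfl

lemma simTranslate_symm_apply (v : E n) (p : (ℝ × SO n) × E n) :
    (simTranslate v).symm p = simTranslate (-v) p := rfl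

lemma measurePreserving_simTranslate {ν : Measure (SO n)} [SFinite ν] (v : E n) :
    MeasurePreserving (simTranslate v) (simMeasure ν) (simMeasure ν) :=
  (MeasurePreserving.id _).prod (measurePreserving_add_right volume v)

section NormSq

variable {α : Type*} [MeasurableSpace α] {μ : Measure α} {g : α → Cl n}

lemma sum_normSq_coord_smul {v : α → E n} (hv : AEMeasurable v μ) (hg : AEStronglyMeasurable g μ) :
    ∑ j, normSq μ (fun x => v x j • g x) = normSq μ (fun x => vec (v x) * g x) := by
  have h_meas : ∀ j, AEMeasurable (fun x => ‖v x j • g x‖ₑ ^ 2) μ := fun j =>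
    have h_coord : AEMeasurable (fun x => v x j) μ := by fun_prop
    (h_coord.aestronglyMeasurable.smul hg).enorm.pow_const 2
  simp_rw [normSq_eq_lintegral]
  rw [← lintegral_finsetSum' _ fun j _ => h_meas j]
  refine lintegral_congr fun x => ?_
  simp_rw [← ofReal_norm, ← ENNReal.ofReal_pow (norm_nonneg _), norm_vec_mul, norm_smul, mul_pow]
  rw [← ENNReal.ofReal_sum_of_nonneg fun _ _ => by positivity, ← Finset.sum_mul,
    EuclideanSpace.norm_sq_eq]

lemma normSq_eq_zero_of_smul {q : α → ℝ} (hq : AEMeasurable q μ) (hq_ne : ∀ᵐ x ∂μ, q x ≠ 0)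
    (hg : AEStronglyMeasurable g μ) (h : normSq μ (fun x => q x • g x) = 0) : normSq μ g = 0 := by
  have h_meas : AEStronglyMeasurable (fun x => q x • g x) μ := hq.aestronglyMeasurable.smul hg
  rw [normSq_eq_eLpNorm_sq, sq_eq_zero_iff, eLpNorm_eq_zero_iff h_meas two_ne_zero] at h
  rw [normSq_eq_eLpNorm_sq, sq_eq_zero_iff, eLpNorm_eq_zero_iff hg two_ne_zero]
  filter_upwards [h, hq_ne] with x hx hqx
  exact (smul_eq_zero.1 hx).resolve_left hqx

lemma normSq_inner_single_smul {μ : Measure (E n)} (s : ℝ) (j : Fin n) (g : E n → Cl n) :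
    normSq μ (fun ω => inner ℝ ω (s • EuclideanSpace.single j (1 : ℝ)) • g ω) =
      ENNReal.ofReal (s ^ 2) * normSq μ (fun ω => ω j • g ω) := by
  rw [← normSq_const_smul]
  simp only [real_inner_smul_right, EuclideanSpace.inner_single_right, one_mul, mul_smul,
    conj_trivial]

end NormSq

lemma ae_coord_ne_zero (j : Fin n) : ∀ᵐ ω : E n, ω j ≠ 0 := by
  have h_proper : LinearMap.ker (EuclideanSpace.proj j : E n →L[ℝ] ℝ).toLinearMap ≠ ⊤ := fun h => by
    simpa using LinearMap.congr_fun (LinearMap.ker_eq_top.1 h) (EuclideanSpace.single j (1 : ℝ))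
  simpa [ae_iff] using! Measure.addHaar_submodule volume _ h_proper

lemma le_mul_of_ne_top_of_eq_zero {x A B : ENNReal} (h : A ≠ ⊤ → B ≠ ⊤ → x ≤ A * B)
    (hA : A = 0 → x = 0) (hB : B = 0 → x = 0) : x ≤ A * B := by
  rcases eq_or_ne A 0 with hA_zero | hA_zero
  · simp [hA hA_zero]
  rcases eq_or_ne B 0 with hB_zero | hB_zero
  · simp [hB hB_zero]
  rcases eq_or_ne A ⊤ with rfl | hA_top
  · simp [ENNReal.top_mul hB_zero]
  rcases eq_or_ne B ⊤ with rfl | hB_top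
  · simp [ENNReal.mul_top hA_zero]
  exact h hA_top hB_top

variable (hn : n % 4 = 2 ∨ n % 4 = 3) {ν : Measure (SO n)} [SFinite ν] {ψ f : E n → Cl n} {c : ℝ}
  (hψ : IsAdmissible ν ψ (algebraMap ℝ (Cl n) c)) (hf : MemLp f 2)

include hn hψ hf

lemma memLp_waveletTransform : MemLp (waveletTransform ψ f) 2 (simMeasure ν) := by
  refine memL2_iff.1 ⟨aestronglyMeasurable_iff_coeff.1
    (aestronglyMeasurable_waveletTransform (memL2_iff.1 hψ.memL2) hf), ?_⟩
  rw [normSq_waveletTransform hn hψ hf]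
  exact ENNReal.mul_lt_top ENNReal.ofReal_lt_top (memL2_iff.2 hf).2

lemma sq_normSq_waveletTransform_le (j : Fin n)
    (hA : normSq (simMeasure ν) (fun p => p.2 j • waveletTransform ψ f p) ≠ ⊤)
    (hB : normSq volume (fun ω => ω j • cft f ω) ≠ ⊤) :
    normSq (simMeasure ν) (waveletTransform ψ f) ^ 2 ≤
      4 * normSq (simMeasure ν) (fun p => p.2 j • waveletTransform ψ f p) *
        (ENNReal.ofReal c * (ENNReal.ofReal ((2 * Real.pi) ^ n)⁻¹ *
          normSq volume (fun ω => ω j • cft f ω))) := by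
  have hT := memLp_waveletTransform hn hψ hf
  have h_coord : AEStronglyMeasurable (fun p : (ℝ × SO n) × E n => p.2 j) (simMeasure ν) :=
    Measurable.aestronglyMeasurable (by fun_prop)
  have hqT : MemLp (fun p => p.2 j • waveletTransform ψ f p) 2 (simMeasure ν) :=
    memL2_iff.1 ⟨aestronglyMeasurable_iff_coeff.1 (h_coord.smul hT.1), hA.lt_top⟩
  simp only [normSq_eq_lintegral (μ := simMeasure ν)]
  refine sq_lintegral_enorm_sq_le
    (τ := fun t => simTranslate (t • EuclideanSpace.single j (1 : ℝ)))
    (fun t => measurePreserving_simTranslate _) (fun p => ?_) (fun t p => ?_) (fun t p => ?_)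
    hT hqT (by finiteness) fun s t => ?_
  · simp [simTranslate_apply]
  · rw [simTranslate_symm_apply, neg_smul]
  · simp [simTranslate_apply]
  · have h_diff := normSq_waveletTransform_translate_sub_le hn hψ hf
      (s • EuclideanSpace.single j (1 : ℝ)) (t • EuclideanSpace.single j (1 : ℝ))
    rw [← sub_smul, normSq_inner_single_smul, normSq_eq_lintegral] at h_diff
    refine h_diff.trans_eq ?_
    ring

lemma normSq_sq_le_coord_of_ne_top (j : Fin n)
    (hA : normSq (simMeasure ν) (fun p => p.2 j • waveletTransform ψ f p) ≠ ⊤)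
    (hB : normSq volume (fun ω => ω j • cft f ω) ≠ ⊤) :
    ENNReal.ofReal c * ENNReal.ofReal ((2 * Real.pi) ^ n / 4) * normSq volume f ^ 2 ≤
      normSq (simMeasure ν) (fun p => p.2 j • waveletTransform ψ f p) *
        normSq volume (fun ω => ω j • cft f ω) := by
  have h_uncertainty := sq_normSq_waveletTransform_le hn hψ hf j hA hB
  rw [normSq_waveletTransform hn hψ hf] at h_uncertainty
  set A := normSq (simMeasure ν) (fun p => p.2 j • waveletTransform ψ f p)
  set B := normSq volume (fun ω => ω j • cft f ω)
  rcases eq_or_ne (ENNReal.ofReal c) 0 with hc | hc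
  · simp [hc]
  have h_const : ENNReal.ofReal ((2 * Real.pi) ^ n / 4) *
      (4 * ENNReal.ofReal ((2 * Real.pi) ^ n)⁻¹) = 1 := by
    rw [← ENNReal.ofReal_ofNat, ← ENNReal.ofReal_mul (by positivity),
      ← ENNReal.ofReal_mul (by positivity), ← ENNReal.ofReal_one]
    field_simp
  rw [← ENNReal.mul_le_mul_iff_right hc ENNReal.ofReal_ne_top]
  calc ENNReal.ofReal c *
        (ENNReal.ofReal c * ENNReal.ofReal ((2 * Real.pi) ^ n / 4) * normSq volume f ^ 2)
      = ENNReal.ofReal ((2 * Real.pi) ^ n / 4) * (ENNReal.ofReal c * normSq volume f) ^ 2 := by ring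
    _ ≤ ENNReal.ofReal ((2 * Real.pi) ^ n / 4) *
          (4 * A * (ENNReal.ofReal c * (ENNReal.ofReal ((2 * Real.pi) ^ n)⁻¹ * B))) := by gcongr
    _ = ENNReal.ofReal ((2 * Real.pi) ^ n / 4) * (4 * ENNReal.ofReal ((2 * Real.pi) ^ n)⁻¹) *
          (ENNReal.ofReal c * (A * B)) := by ring
    _ = ENNReal.ofReal c * (A * B) := by rw [h_const, one_mul]

theorem normSq_sq_le_coord (j : Fin n) :
    ENNReal.ofReal c * ENNReal.ofReal ((2 * Real.pi) ^ n / 4) * normSq volume f ^ 2 ≤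
      normSq (simMeasure ν) (fun p => p.2 j • waveletTransform ψ f p) *
        normSq volume (fun ω => ω j • cft f ω) := by
  refine le_mul_of_ne_top_of_eq_zero (normSq_sq_le_coord_of_ne_top hn hψ hf j) (fun hA => ?_)
    fun hB => ?_
  · have h_zero := normSq_eq_zero_of_smul (μ := simMeasure ν) (by fun_prop)
      (Measure.quasiMeasurePreserving_snd.ae (ae_coord_ne_zero j))
      (memLp_waveletTransform hn hψ hf).1 hA
    rw [normSq_waveletTransform hn hψ hf] at h_zero
    rw [mul_right_comm, sq, ← mul_assoc, h_zero, zero_mul, zero_mul]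
  · have h_zero := normSq_eq_zero_of_smul (by fun_prop) (ae_coord_ne_zero j) (memLp_cft hn hf).1 hB
    have h_pos : ENNReal.ofReal ((2 * Real.pi) ^ n) ≠ 0 := by positivity
    rw [normSq_cft hn hf, mul_eq_zero, or_iff_right h_pos] at h_zero
    rw [h_zero, zero_pow two_ne_zero, mul_zero]

end Main

end CliffordWavelet

end

open CliffordWavelet in
theorem mainTheorem4_general {n : ℕ} (hn : n % 4 = 2 ∨ n % 4 = 3) {ν : Measure (SO n)} [SFinite ν]
    {ψ : E n → Cl n} {c : ℝ} (hψ : IsAdmissible ν ψ (algebraMap ℝ (Cl n) c)) {f : E n → Cl n}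
    (hf : MemL2 volume f) :
    ENNReal.ofReal (n * c * ((2 * Real.pi) ^ n / 4)) * normSq volume f ^ 2 ≤
      normSq (simMeasure ν) (fun p => vec p.2 * waveletTransform ψ f p) *
        normSq volume (fun ω => vec ω * cft f ω) := by
  have hf2 : MemLp f 2 := memL2_iff.1 hf
  rw [← sum_normSq_coord_smul (by fun_prop) (memLp_waveletTransform hn hψ hf2).1,
    ← sum_normSq_coord_smul (by fun_prop) (memLp_cft hn hf2).1]
  calc ENNReal.ofReal (n * c * ((2 * Real.pi) ^ n / 4)) * normSq volume f ^ 2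
      = ∑ _j : Fin n,
          ENNReal.ofReal c * ENNReal.ofReal ((2 * Real.pi) ^ n / 4) * normSq volume f ^ 2 := by
        rw [Finset.sum_const, Finset.card_univ, Fintype.card_fin, nsmul_eq_mul,
          ENNReal.ofReal_mul' (by positivity), ENNReal.ofReal_mul (by positivity),
          ENNReal.ofReal_natCast, mul_assoc, mul_assoc, mul_assoc]
    _ ≤ ∑ j : Fin n, normSq (simMeasure ν) (fun p => p.2 j • waveletTransform ψ f p) *
          normSq volume (fun ω => ω j • cft f ω) :=
        Finset.sum_le_sum fun j _ => normSq_sq_le_coord hn hψ hf2 j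
    _ ≤ (∑ j : Fin n, normSq (simMeasure ν) (fun p => p.2 j • waveletTransform ψ f p)) *
          ∑ j : Fin n, normSq volume (fun ω => ω j • cft f ω) := by
        rw [Finset.sum_mul]
        gcongr with j
        exact Finset.single_le_sum (f := fun j => normSq volume (fun ω => ω j • cft f ω))
          (fun _ _ => zero_le) (Finset.mem_univ j)

theorem mainTheorem4 (n : ℕ) (hn : n % 4 = 2 ∨ n % 4 = 3)
    (ν : MeasureTheory.Measure (CliffordWavelet.SO n)) [ν.IsHaarMeasure]
    (ψ : CliffordWavelet.E n → CliffordWavelet.Cl n) (c : ℝ)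
    (hψ : CliffordWavelet.IsAdmissible ν ψ (algebraMap ℝ (CliffordWavelet.Cl n) c))
    (f : CliffordWavelet.E n → CliffordWavelet.Cl n)
    (hf : CliffordWavelet.MemL2 MeasureTheory.volume f) :
    ENNReal.ofReal (n * c * ((2 * Real.pi) ^ n / 4)) *
        CliffordWavelet.normSq MeasureTheory.volume f ^ 2 ≤
      CliffordWavelet.normSq (CliffordWavelet.simMeasure ν)
          (fun p => CliffordWavelet.vec p.2 * CliffordWavelet.waveletTransform ψ f p) *
        CliffordWavelet.normSq MeasureTheory.volume
          (fun ω => CliffordWavelet.vec ω * CliffordWavelet.cft f ω) :=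
  mainTheorem4_general hn hψ hf
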